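/- Let $\mathbb R_5$ be the real Clifford algebra generated by $e_1,\dots,e_5$ with $e_i^2=-1$ and $e_ie_j=-e_je_i$ for $i\neq j$. Identify $x=(x_0,\dots,x_5)\in\mathbb R^6$ with the paravector $x=x_0+\sum_{i=1}^5x_ie_i\in\mathbb R_5$, and put $\overline x=x_0-\sum_{i=1}^5x_ie_i$, $\mathrm{Re}(x)=x_0$, $|x|^2=\sum_{i=0}^5x_i^2$. Let $$\mathcal Q_{c,s}(x)=s^2-2\,\mathrm{Re}(x)\,s+|x|^2,\qquad S_L^{-1}(s,x)=(s-\overline x)\,\mathcal Q_{c,s}(x)^{-1},\qquad S_R^{-1}(s,x)=\mathcal Q_{c,s}(x)^{-1}(s-\overline x)$$ be the left and right slice hyperholomorphic Cauchy kernels. In the variable $x$ let $\Delta=\sum_{i=0}^5\partial_{x_i}^2$, let $\mathcal D f=\partial_{x_0}f+\sum_{i=1}^5e_i\partial_{x_i}f$ and $\overline{\mathcal D}f=\partial_{x_0}f-\sum_{i=1}^5e_i\partial_{x_i}f$ be the operators acting from the left, and let $f\mathcal D=\partial_{x_0}f+\sum_{i=1}^5(\partial_{x_i}f)e_i$ and $f\overline{\mathcal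 D}=\partial_{x_0}f-\sum_{i=1}^5(\partial_{x_i}f)e_i$ be those acting from the right (composites on the right are applied from left to right). The fine structure kernels are $$S^{-1}_{\mathcal D,L}=\mathcal D S_L^{-1},\quad S^{-1}_{\Delta,L}=\Delta S_L^{-1},\quad S^{-1}_{\Delta\mathcal D,L}=\Delta\mathcal D S_L^{-1},\quad S^{-1}_{\mathcal D^2,L}=\mathcal D^2S_L^{-1},\quad S^{-1}_{\overline{\mathcal D},L}=\overline{\mathcal D}S_L^{-1},\quad S^{-1}_{\overline{\mathcal D}^2,L}=\overline{\mathcal D}^2S_L^{-1},\quad S^{-1}_{\Delta\overline{\mathcal D},L}=\Delta\overline{\mathcal D}S_L^{-1},$$ $$S^{-1}_{\mathcal D,R}=S_R^{-1}\mathcal D,\quad S^{-1}_{\Delta,R}=\Delta S_R^{-1},\quad S^{-1}_{\Delta\mathcal D,R}=S_R^{-1}\mathcal D\Delta,\quad S^{-1}_{\mathcal D^2,R}=S_R^{-1}\mathcal D^2,\quad S^{-1}_{\overline{\mathcal D},R}=S_R^{-1}\overline{\mathcal D},\quad S^{-1}_{\overline{\mathcal D}^2,R}=S_R^{-1}\overline{\mathcal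 D}^2,\quad S^{-1}_{\Delta\overline{\mathcal D},R}=S_R^{-1}\Delta\overline{\mathcal D}.$$ Let $s,x\in\mathbb R^6$ with $|x|<|s|$. Then $s$ and $\mathcal Q_{c,s}(x)$ are invertible in $\mathbb R_5$, the kernels $S_L^{-1}(s,\cdot)$ and $S_R^{-1}(s,\cdot)$ are smooth near $x$, and the following series converge to the kernels as stated: $$S^{-1}_{\mathcal D,L}(s,x)=-4\sum_{m=1}^\infty\sum_{k=1}^m x^{m-k}\overline x^{k-1}s^{-1-m},\qquad S^{-1}_{\mathcal D,R}(s,x)=-4\sum_{m=1}^\infty\sum_{k=1}^m s^{-1-m}x^{m-k}\overline x^{k-1},$$ $$S^{-1}_{\Delta,L}(s,x)=-8\sum_{m=2}^\infty\sum_{k=1}^{m-1}(m-k)x^{m-k-1}\overline x^{k-1}s^{-1-m},\qquad S^{-1}_{\Delta,R}(s,x)=-8\sum_{m=2}^\infty\sum_{k=1}^{m-1}(m-k)s^{-1-m}x^{m-k-1}\overline x^{k-1},$$ $$S^{-1}_{\Delta\mathcal D,L}(s,x)=16\sum_{m=3}^\infty\sum_{k=1}^{m-2}(m-k-1)k\,x^{m-k-2}\overline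 x^{k-1}s^{-1-m},\qquad S^{-1}_{\Delta\mathcal D,R}(s,x)=16\sum_{m=3}^\infty\sum_{k=1}^{m-2}(m-k-1)k\,s^{-1-m}x^{m-k-2}\overline x^{k-1},$$ $$S^{-1}_{\mathcal D^2,L}(s,x)=-8\sum_{m=2}^\infty\sum_{k=1}^{m-1}k\,x^{m-k-1}\overline x^{k-1}s^{-1-m},\qquad S^{-1}_{\mathcal D^2,R}(s,x)=-8\sum_{m=2}^\infty\sum_{k=1}^{m-1}k\,s^{-1-m}x^{m-k-1}\overline x^{k-1},$$ $$S^{-1}_{\overline{\mathcal D},L}(s,x)=2\sum_{m=1}^\infty\Big(mx^{m-1}+2\sum_{k=1}^mx^{m-k}\overline x^{k-1}\Big)s^{-1-m},\qquad S^{-1}_{\overline{\mathcal D},R}(s,x)=2\sum_{m=1}^\infty s^{-1-m}\Big(mx^{m-1}+2\sum_{k=1}^mx^{m-k}\overline x^{k-1}\Big),$$ $$S^{-1}_{\overline{\mathcal D}^2,L}(s,x)=4\sum_{m=2}^\infty\Big(m(m-1)x^{m-2}+2\sum_{k=1}^{m-1}(2m-k)x^{m-k-1}\overline x^{k-1}\Big)s^{-1-m},$$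 $$S^{-1}_{\overline{\mathcal D}^2,R}(s,x)=4\sum_{m=2}^\infty s^{-1-m}\Big(m(m-1)x^{m-2}+2\sum_{k=1}^{m-1}(2m-k)x^{m-k-1}\overline x^{k-1}\Big),$$ $$S^{-1}_{\Delta\overline{\mathcal D},L}(s,x)=-16\sum_{m=3}^\infty\sum_{k=1}^{m-2}(m-k-1)(m+k)x^{m-k-2}\overline x^{k-1}s^{-1-m},$$ $$S^{-1}_{\Delta\overline{\mathcal D},R}(s,x)=-16\sum_{m=3}^\infty\sum_{k=1}^{m-2}(m-k-1)(m+k)s^{-1-m}x^{m-k-2}\overline x^{k-1}.$$ -/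

import Mathlib

noncomputable section

namespace FineStructure

open scoped Laplacian

/-- The points of `ℝ⁶`, with the Euclidean norm. -/
abbrev E6 : Type := EuclideanSpace ℝ (Fin 6)

/-- The negative definite form `y ↦ -(y₁² + ⋯ + y₅²)` on `ℝ⁵`. -/
abbrev Q5 : QuadraticForm ℝ (Fin 5 → ℝ) :=
  QuadraticMap.weightedSumSquares ℝ (fun _ : Fin 5 => (-1 : ℝ))

/-- The real Clifford algebra `ℝ_5` over five imaginary units. -/
abbrev R5 : Type := CliffordAlgebra Q5

/-- The imaginary unit `e_{i+1}`, `i = 0, …, 4`. -/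
def e (i : Fin 5) : R5 := CliffordAlgebra.ι Q5 (Pi.single i 1)

theorem e_mul_self (i : Fin 5) : e i * e i = -1 := by
  rw [e, CliffordAlgebra.ι_sq_scalar]
  simp [Q5, QuadraticMap.weightedSumSquares_apply, Pi.single_apply]

theorem e_mul_add_swap {i j : Fin 5} (h : i ≠ j) : e i * e j + e j * e i = 0 := by
  rw [e, e, CliffordAlgebra.ι_mul_ι_add_swap]
  have : QuadraticMap.polar Q5 (Pi.single i 1) (Pi.single j 1) = 0 := by
    simp only [QuadraticMap.polar, Q5, QuadraticMap.weightedSumSquares_apply]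
    fin_cases i <;> fin_cases j <;> simp_all [Fin.sum_univ_five, Pi.single_apply]
  rw [this, map_zero]

/-- A basis of `ℝ_5`, indexed by the subsets of the five units (it corresponds to the exterior
products of the standard basis vectors of `ℝ⁵`). -/
def bladeBasis : Module.Basis (Finset (Fin 5)) ℝ R5 :=
  (Pi.basisFun ℝ (Fin 5)).ExteriorAlgebra.map (CliffordAlgebra.equivExterior Q5).symm

instance instFiniteR5 : Module.Finite ℝ R5 := Module.Finite.of_basis bladeBasis

/-- The norm of `a` is the norm of the matrix of left multiplication by `a`.  As `ℝ_5` has finite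
dimension, all its norms are equivalent: only the resulting topology matters for derivatives and
for the convergence of series. -/
instance instNormedRingR5 : NormedRing R5 :=
  letI : NormedRing (Matrix (Finset (Fin 5)) (Finset (Fin 5)) ℝ) := Matrix.linftyOpNormedRing
  NormedRing.induced R5 (Matrix (Finset (Fin 5)) (Finset (Fin 5)) ℝ)
    (Algebra.leftMulMatrix bladeBasis) (Algebra.leftMulMatrix_injective bladeBasis)

instance instNormedAlgebraR5 : NormedAlgebra ℝ R5 :=
  letI : NormedRing (Matrix (Finset (Fin 5)) (Finset (Fin 5)) ℝ) := Matrix.linftyOpNormedRing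
  letI : NormedAlgebra ℝ (Matrix (Finset (Fin 5)) (Finset (Fin 5)) ℝ) :=
    Matrix.linftyOpNormedAlgebra
  NormedAlgebra.induced ℝ R5 (Matrix (Finset (Fin 5)) (Finset (Fin 5)) ℝ)
    (Algebra.leftMulMatrix bladeBasis)

/-- The paravector `x = x₀ + x₁ e₁ + ⋯ + x₅ e₅`. -/
def par (x : E6) : R5 := algebraMap ℝ R5 (x 0) + ∑ i : Fin 5, x i.succ • e i

/-- The conjugate `x̄ = x₀ - x₁ e₁ - ⋯ - x₅ e₅`. -/
def conj (x : E6) : R5 := algebraMap ℝ R5 (x 0) - ∑ i : Fin 5, x i.succ • e i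

/-- `Q_{c,s}(x) = s² - 2 Re(x) s + |x|²`. -/
def Qc (s x : E6) : R5 :=
  par s ^ 2 - (2 * x 0) • par s + algebraMap ℝ R5 (‖x‖ ^ 2)

/-- The left slice hyperholomorphic Cauchy kernel `S_L⁻¹(s,x) = (s - x̄) Q_{c,s}(x)⁻¹`. -/
def SL (s x : E6) : R5 := (par s - conj x) * Ring.inverse (Qc s x)

/-- The right slice hyperholomorphic Cauchy kernel `S_R⁻¹(s,x) = Q_{c,s}(x)⁻¹ (s - x̄)`. -/
def SR (s x : E6) : R5 := Ring.inverse (Qc s x) * (par s - conj x)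

/-- The partial derivative `∂f/∂x_i`, `i = 0, …, 5`. -/
def pd (i : Fin 6) (f : E6 → R5) (x : E6) : R5 := lineDeriv ℝ f x (EuclideanSpace.single i 1)

/-- The Dirac operator acting from the left, `D f = ∂₀ f + ∑ e_i ∂_i f`. -/
def diracL (f : E6 → R5) (x : E6) : R5 := pd 0 f x + ∑ i : Fin 5, e i * pd i.succ f x

/-- The Dirac operator acting from the right, `f D = ∂₀ f + ∑ (∂_i f) e_i`. -/
def diracR (f : E6 → R5) (x : E6) : R5 := pd 0 f x + ∑ i : Fin 5, pd i.succ f x * e i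

/-- The conjugate Dirac operator acting from the left, `D̄ f = ∂₀ f - ∑ e_i ∂_i f`. -/
def diracBarL (f : E6 → R5) (x : E6) : R5 := pd 0 f x - ∑ i : Fin 5, e i * pd i.succ f x

/-- The conjugate Dirac operator acting from the right, `f D̄ = ∂₀ f - ∑ (∂_i f) e_i`. -/
def diracBarR (f : E6 → R5) (x : E6) : R5 := pd 0 f x - ∑ i : Fin 5, pd i.succ f x * e i

/-! The fine structure kernels: the operators act on the Cauchy kernels in the variable `x`. -/

/-- `S⁻¹_{D,L}(s,x) = D (S_L⁻¹(s,x))`. -/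
def kernelDL (s : E6) : E6 → R5 := diracL (SL s)
/-- `S⁻¹_{D,R}(s,x) = (S_R⁻¹(s,x)) D`. -/
def kernelDR (s : E6) : E6 → R5 := diracR (SR s)
/-- `S⁻¹_{Δ,L}(s,x) = Δ S_L⁻¹(s,x)`. -/
def kernelLapL (s : E6) : E6 → R5 := Δ (SL s)
/-- `S⁻¹_{Δ,R}(s,x) = Δ S_R⁻¹(s,x)`. -/
def kernelLapR (s : E6) : E6 → R5 := Δ (SR s)
/-- `S⁻¹_{ΔD,L}(s,x) = Δ D (S_L⁻¹(s,x))`. -/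
def kernelLapDL (s : E6) : E6 → R5 := Δ (diracL (SL s))
/-- `S⁻¹_{ΔD,R}(s,x) = (S_R⁻¹(s,x)) D Δ`. -/
def kernelLapDR (s : E6) : E6 → R5 := Δ (diracR (SR s))
/-- `S⁻¹_{D²,L}(s,x) = D² (S_L⁻¹(s,x))`. -/
def kernelDDL (s : E6) : E6 → R5 := diracL (diracL (SL s))
/-- `S⁻¹_{D²,R}(s,x) = (S_R⁻¹(s,x)) D²`. -/
def kernelDDR (s : E6) : E6 → R5 := diracR (diracR (SR s))
/-- `S⁻¹_{D̄,L}(s,x) = D̄ (S_L⁻¹(s,x))`. -/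
def kernelDbarL (s : E6) : E6 → R5 := diracBarL (SL s)
/-- `S⁻¹_{D̄,R}(s,x) = (S_R⁻¹(s,x)) D̄`. -/
def kernelDbarR (s : E6) : E6 → R5 := diracBarR (SR s)
/-- `S⁻¹_{D̄²,L}(s,x) = D̄² (S_L⁻¹(s,x))`. -/
def kernelDbarDbarL (s : E6) : E6 → R5 := diracBarL (diracBarL (SL s))
/-- `S⁻¹_{D̄²,R}(s,x) = (S_R⁻¹(s,x)) D̄²`. -/
def kernelDbarDbarR (s : E6) : E6 → R5 := diracBarR (diracBarR (SR s))
/-- `S⁻¹_{ΔD̄,L}(s,x) = Δ D̄ (S_L⁻¹(s,x))`. -/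
def kernelLapDbarL (s : E6) : E6 → R5 := Δ (diracBarL (SL s))
/-- `S⁻¹_{ΔD̄,R}(s,x) = (S_R⁻¹(s,x)) Δ D̄`. -/
def kernelLapDbarR (s : E6) : E6 → R5 := diracBarR (Δ (SR s))

/-- The power `s^{-1-m}`. -/
def negPow (s : E6) (m : ℕ) : R5 := Ring.inverse (par s) ^ (1 + m)

/-- `HasSumFrom a u S` says that `∑_{m=a}^∞ u m` converges, with sum `S`. -/
def HasSumFrom (a : ℕ) (u : ℕ → R5) (S : R5) : Prop := HasSum (fun n : ℕ => u (n + a)) S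

end FineStructure

end

/-! Let `σ` be right multiplication by `s`. It commutes with left multiplication by every `e i`, so
on the operator algebra of `R5` it plays the role of a scalar. Write `p = (σ - x)⁻¹` and `r = (σ -
x̄)⁻¹`, with `x`, `x̄` acting on the left. Since `(σ - x)(σ - x̄)` is right multiplication by `Qc s
x`, the kernel `SL s x` is `p` applied to `1` (`SL_eq_res`). Exchanging left and right turns `SR`
into the same object, so one abstract computation serves both sides.

Differentiation is algebraic: `∂ᵢ p = p eᵢ p`, with `e₀ = 1`, and likewise for `r` with the
conjugate units. Each operator thus becomes a sum of sandwiches `∑ eᵢ y eᵢ` with `y` a monomial in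
`p` and `r`. Such a `y` is `a + X b`, where `X` is the vector part of `x` and `a`, `b` commute with
the units. For it `∑ eᵢ y eᵢ = -4 ȳ` and `∑ eᵢ y ēᵢ = 2 y + 4 ȳ`, where the bar exchanges `p` and
`r` (`ConjPair` and its lemmas). Hence `D p = -4pr`, `D̄ p = 2p² + 4pr`, `Δ p = -8p²r`, `D² p =
-8pr²`, `ΔD p = 16p²r²`, `D̄² p = 8p³ + 16p²r + 8pr²`, `ΔD̄ p = -32p³r - 32p²r²`.

For `|x| < |s|` the Neumann series `p = ∑ xⁿ σ⁻ⁿ⁻¹` and its conjugate converge absolutely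
(`hasAbsSum_resolvent`), and Cauchy products expand these monomials into the stated series.
Convergence uses that each paravector lies in a copy of `ℂ`, where powers have size `|x|ⁿ`
(`exists_algHom_complex`). -/

noncomputable section

namespace FineStructure

open scoped Laplacian

/-! ### Clifford families, conjugate pairs and sandwich sums -/

section Abstract

variable {A : Type*} [NormedRing A]

/-- A family of five imaginary units commuting with `σ`. -/
structure IsCliffordFamily (E : Fin 5 → A) (σ : A) : Prop where
  mul_self : ∀ i, E i * E i = -1
  anticomm : ∀ i j, i ≠ j → E i * E j + E j * E i = 0
  comm : ∀ i, Commute (E i) σ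

/-- Changing the sign of the units is conjugation, so results on `x̄`, `r` and `D̄` are instances of
those for a Clifford family. -/
theorem IsCliffordFamily.neg {E : Fin 5 → A} {σ : A} (h : IsCliffordFamily E σ) :
    IsCliffordFamily (-E) σ where
  mul_self i := by simpa using h.mul_self i
  anticomm i j hij := by simpa using h.anticomm i j hij
  comm i := (h.comm i).neg_left

variable [NormedAlgebra ℝ A]

/-- The vector `∑ xᵢ Eᵢ`. -/
def vecOf (E : Fin 5 → A) (x : E6) : A := ∑ i : Fin 5, x i.succ • E i

/-- The paravector `x₀ + ∑ xᵢ Eᵢ`. -/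
def parOf (E : Fin 5 → A) (x : E6) : A := algebraMap ℝ A (x 0) + ∑ i : Fin 5, x i.succ • E i

/-- The units `1, E₁, …, E₅`. -/
def unitOf (E : Fin 5 → A) : Fin 6 → A := Fin.cons 1 E

/-- The resolvent of the paravector. -/
def res (E : Fin 5 → A) (σ : A) (x : E6) : A := Ring.inverse (σ - parOf E x)

theorem parOf_eq_add (E : Fin 5 → A) (x : E6) :
    parOf E x = algebraMap ℝ A (x 0) + vecOf E x := rfl

theorem vecOf_neg (E : Fin 5 → A) (x : E6) : vecOf (-E) x = -vecOf E x := by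
  simp [vecOf]

theorem parOf_neg (E : Fin 5 → A) (x : E6) :
    parOf (-E) x = algebraMap ℝ A (x 0) - vecOf E x := by
  rw [parOf_eq_add, vecOf_neg, sub_eq_add_neg]

theorem parOf_eq_sum (E : Fin 5 → A) (x : E6) : parOf E x = ∑ i : Fin 6, x i • unitOf E i := by
  rw [Fin.sum_univ_succ]
  simp [parOf, unitOf, Algebra.algebraMap_eq_smul_one]

theorem norm_sq_eq (x : E6) : ‖x‖ ^ 2 = x 0 ^ 2 + ∑ i : Fin 5, x i.succ ^ 2 := by
  rw [EuclideanSpace.real_norm_sq_eq, Fin.sum_univ_succ]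

section Algebra

variable {E : Fin 5 → A} {σ : A}

/-- Symmetrising the double sum leaves only anticommutators, which vanish off the diagonal and equal
`-2` on it. -/
theorem vecOf_mul_self (h : IsCliffordFamily E σ) (x : E6) :
    vecOf E x * vecOf E x = algebraMap ℝ A (-∑ i : Fin 5, x i.succ ^ 2) := by
  have key : ∀ i j : Fin 5, E i * E j + E j * E i = if i = j then (-2 : ℝ) • (1 : A) else 0 := by
    intro i j
    split_ifs with hij
    · subst hij
      rw [h.mul_self, neg_smul, two_smul]; abel
    · exact h.anticomm i j hij
  have h2 : (2 : ℝ) • (vecOf E x * vecOf E x) =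
      ∑ i : Fin 5, ∑ j : Fin 5, (x i.succ * x j.succ) • (E i * E j + E j * E i) := by
    have e1 : vecOf E x * vecOf E x =
        ∑ i : Fin 5, ∑ j : Fin 5, (x i.succ * x j.succ) • (E i * E j) := by
      simp only [vecOf, Finset.sum_mul_sum, smul_mul_smul_comm]
    have e2 : vecOf E x * vecOf E x =
        ∑ i : Fin 5, ∑ j : Fin 5, (x i.succ * x j.succ) • (E j * E i) := by
      rw [e1, Finset.sum_comm]
      simp only [mul_comm]
    simp only [smul_add, Finset.sum_add_distrib]
    rw [← e1, ← e2, two_smul]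
  have h3 : (2 : ℝ) • (vecOf E x * vecOf E x) =
      (2 : ℝ) • algebraMap ℝ A (-∑ i : Fin 5, x i.succ ^ 2) := by
    rw [h2]
    simp only [key, smul_ite, smul_zero, Finset.sum_ite_eq, Finset.mem_univ, if_true, smul_smul,
      ← Finset.sum_smul, Algebra.algebraMap_eq_smul_one]
    congr 1
    rw [mul_neg, Finset.mul_sum, ← Finset.sum_neg_distrib]
    exact Finset.sum_congr rfl fun i _ => by ring
  exact smul_right_injective A (two_ne_zero (α := ℝ)) h3

/-- For fixed `j`, `Eᵢ Eⱼ Eᵢ` is `Eⱼ` for the four `i ≠ j` and `-Eⱼ` for `i = j`, so the total is `4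
- 1 = 3`. -/
theorem sum_mul_vecOf_mul (h : IsCliffordFamily E σ) (x : E6) :
    ∑ i, E i * vecOf E x * E i = (3 : ℝ) • vecOf E x := by
  have key : ∀ i j : Fin 5, E i * E j * E i = E j - if i = j then (2 : ℝ) • E j else 0 := by
    intro i j
    split_ifs with hij
    · subst hij
      rw [h.mul_self, two_smul]; simp
    · rw [eq_neg_of_add_eq_zero_left (h.anticomm i j hij), neg_mul, mul_assoc, h.mul_self]
      simp
  simp only [vecOf, Finset.mul_sum, Finset.sum_mul, mul_smul_comm, smul_mul_assoc]
  rw [Finset.sum_comm, Finset.smul_sum]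
  refine Finset.sum_congr rfl fun j _ => ?_
  rw [← Finset.smul_sum]
  simp only [key, Finset.sum_sub_distrib, Finset.sum_ite_eq', Finset.mem_univ, if_true,
    Finset.sum_const, Finset.card_univ, Fintype.card_fin]
  rw [smul_comm (3 : ℝ)]
  congr 1
  module

theorem sum_mul_mul_of_commute (h : IsCliffordFamily E σ) {a : A} (ha : ∀ i, Commute (E i) a) :
    ∑ i, E i * a * E i = (-5 : ℝ) • a := by
  have : ∀ i, E i * a * E i = -a := fun i => by
    rw [(ha i).eq, mul_assoc, h.mul_self]; simp
  simp only [this, Finset.sum_const, Finset.card_univ, Fintype.card_fin]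
  module

/-- `y = a + X b` and `z = a - X b` for the vector `X` of `x` and for `a`, `b` that commute with
the imaginary units. -/
def ConjPair (E : Fin 5 → A) (x : E6) (y z : A) : Prop :=
  ∃ a b : A, (∀ i, Commute (E i) a) ∧ (∀ i, Commute (E i) b) ∧
    y = a + vecOf E x * b ∧ z = a - vecOf E x * b

theorem ConjPair.symm {x : E6} {y z : A} (h : ConjPair E x y z) : ConjPair E x z y := by
  obtain ⟨a, b, ha, hb, rfl, rfl⟩ := h
  exact ⟨a, -b, ha, fun i => (hb i).neg_right, by simp [sub_eq_add_neg], by simp⟩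

theorem commute_vecOf {x : E6} {a : A} (ha : ∀ i, Commute (E i) a) : Commute (vecOf E x) a :=
  Commute.sum_left _ _ _ fun i _ => (ha i).smul_left _

/-- `X²` is real and `X` commutes with the coefficients, so the elements `a + X b` multiply as over
a commuting imaginary unit and `X ↦ -X` respects products without reversing them. -/
theorem ConjPair.mul (h : IsCliffordFamily E σ) {x : E6} {y z y' z' : A}
    (h₁ : ConjPair E x y z) (h₂ : ConjPair E x y' z') : ConjPair E x (y * y') (z * z') := by
  obtain ⟨a, b, ha, hb, rfl, rfl⟩ := h₁
  obtain ⟨c, d, hc, hd, rfl, rfl⟩ := h₂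
  set X := vecOf E x with hX
  set t : A := algebraMap ℝ A (-∑ i : Fin 5, x i.succ ^ 2)
  have hXX : X * X = t := vecOf_mul_self h x
  have e1 : a * (X * d) = X * (a * d) := by
    rw [← mul_assoc, ← (commute_vecOf ha).eq, mul_assoc]
  have e2 : X * b * (X * d) = t * (b * d) := by
    rw [mul_assoc, ← mul_assoc b, ← (commute_vecOf hb).eq, mul_assoc, ← mul_assoc, hXX]
  refine ⟨a * c + t * (b * d), a * d + b * c, fun i => ?_, fun i => ?_, ?_, ?_⟩
  · exact ((ha i).mul_right (hc i)).add_right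
      ((Algebra.commute_algebraMap_right _ _).mul_right ((hb i).mul_right (hd i)))
  · exact ((ha i).mul_right (hd i)).add_right ((hb i).mul_right (hc i))
  · rw [add_mul, mul_add, mul_add, e1, e2, mul_assoc, mul_add]; abel
  · rw [sub_mul, mul_sub, mul_sub, e1, e2, mul_assoc, mul_add]; abel

/-- The part `a` is multiplied by `-5` and the part `X b` by `3`; both factors are recovered from
`-y - 4z`. -/
theorem ConjPair.sum_mul_mul (h : IsCliffordFamily E σ) {x : E6} {y z : A}
    (hy : ConjPair E x y z) : ∑ i, E i * y * E i = -y - (4 : ℝ) • z := by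
  obtain ⟨a, b, ha, hb, rfl, rfl⟩ := hy
  have : ∀ i, E i * (a + vecOf E x * b) * E i = E i * a * E i + E i * vecOf E x * E i * b := by
    intro i
    rw [mul_add, add_mul, ← mul_assoc, mul_assoc _ b, ← (hb i).eq, ← mul_assoc]
  simp only [this, Finset.sum_add_distrib]
  rw [sum_mul_mul_of_commute h ha, ← Finset.sum_mul, sum_mul_vecOf_mul h, smul_mul_assoc]
  module

theorem ConjPair.sum_unit_unit (h : IsCliffordFamily E σ) {x : E6} {y z : A}
    (hy : ConjPair E x y z) : ∑ i, unitOf E i * y * unitOf E i = -(4 : ℝ) • z := by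
  rw [Fin.sum_univ_succ]
  simp only [unitOf, Fin.cons_zero, Fin.cons_succ, hy.sum_mul_mul h, one_mul, mul_one]
  module

theorem ConjPair.sum_unit_neg (h : IsCliffordFamily E σ) {x : E6} {y z : A}
    (hy : ConjPair E x y z) :
    ∑ i, unitOf E i * y * unitOf (-E) i = (2 : ℝ) • y + (4 : ℝ) • z := by
  rw [Fin.sum_univ_succ]
  simp only [unitOf, Fin.cons_zero, Fin.cons_succ, Pi.neg_apply, mul_neg, Finset.sum_neg_distrib,
    hy.sum_mul_mul h, one_mul, mul_one]
  module

theorem ConjPair.sum_neg_unit (h : IsCliffordFamily E σ) {x : E6} {y z : A}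
    (hy : ConjPair E x y z) :
    ∑ i, unitOf (-E) i * y * unitOf E i = (2 : ℝ) • y + (4 : ℝ) • z := by
  rw [Fin.sum_univ_succ]
  simp only [unitOf, Fin.cons_zero, Fin.cons_succ, Pi.neg_apply, neg_mul, Finset.sum_neg_distrib,
    hy.sum_mul_mul h, one_mul, mul_one]
  module

theorem ConjPair.sum_neg_neg (h : IsCliffordFamily E σ) {x : E6} {y z : A}
    (hy : ConjPair E x y z) :
    ∑ i, unitOf (-E) i * y * unitOf (-E) i = -(4 : ℝ) • z := by
  rw [Fin.sum_univ_succ]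
  simp only [unitOf, Fin.cons_zero, Fin.cons_succ, Pi.neg_apply, neg_mul, mul_neg, neg_neg,
    hy.sum_mul_mul h, one_mul, mul_one]
  module

theorem commute_parOf_sigma (h : IsCliffordFamily E σ) (x : E6) : Commute (parOf E x) σ :=
  (Algebra.commute_algebraMap_left _ _).add_left (commute_vecOf h.comm)

theorem commute_parOf_neg (E : Fin 5 → A) (x : E6) : Commute (parOf E x) (parOf (-E) x) := by
  rw [parOf_neg, parOf_eq_add]
  exact Commute.add_left (Algebra.commute_algebraMap_left _ _)
    ((Algebra.commute_algebraMap_right _ _).sub_right (Commute.refl _))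

theorem commute_sub_parOf (h : IsCliffordFamily E σ) (x : E6) :
    Commute (σ - parOf E x) (σ - parOf (-E) x) :=
  ((Commute.refl σ).sub_right (commute_parOf_sigma h.neg x).symm).sub_left
    ((commute_parOf_sigma h x).sub_right (commute_parOf_neg E x))

theorem parOf_mul_parOf_neg (h : IsCliffordFamily E σ) (x : E6) :
    parOf E x * parOf (-E) x = algebraMap ℝ A (‖x‖ ^ 2) := by
  rw [parOf_neg, parOf_eq_add, norm_sq_eq, add_mul, mul_sub, mul_sub, vecOf_mul_self h,
    ← Algebra.commutes (x 0) (vecOf E x), map_neg, map_add, map_pow]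
  noncomm_ring

/-- Only `x + x̄ = 2x₀`, `x x̄ = |x|²` and commutation with `σ` enter. -/
theorem sub_parOf_mul_sub_parOf_neg (h : IsCliffordFamily E σ) (x : E6) :
    (σ - parOf E x) * (σ - parOf (-E) x) =
      σ ^ 2 - (2 * x 0) • σ + algebraMap ℝ A (‖x‖ ^ 2) := by
  have e : parOf E x * σ + parOf (-E) x * σ = (2 * x 0) • σ := by
    rw [← add_mul, parOf_neg, parOf_eq_add, Algebra.smul_def]
    congr 1
    rw [two_mul, map_add]; abel
  rw [sub_mul, mul_sub, mul_sub, parOf_mul_parOf_neg h, ← (commute_parOf_sigma h.neg x).eq, ← e]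
  noncomm_ring

theorem commute_res (h : IsCliffordFamily E σ) (x : E6) :
    Commute (res E σ x) (res (-E) σ x) :=
  (commute_sub_parOf h x).ringInverse_ringInverse

/-- The product `c = p r` inverts a polynomial in `σ` with real coefficients, hence commutes with
the units; then `p = (σ - x̄) c` and `r = (σ - x) c` have the required form. -/
theorem conjPair_res (h : IsCliffordFamily E σ) {x : E6} (hu : IsUnit (σ - parOf E x))
    (hv : IsUnit (σ - parOf (-E) x)) : ConjPair E x (res E σ x) (res (-E) σ x) := by
  set c := res E σ x * res (-E) σ x with hc
  have hce : ∀ i, Commute (E i) c := by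
    intro i
    have hq : Commute (E i) ((σ - parOf (-E) x) * (σ - parOf E x)) := by
      rw [← (commute_sub_parOf h x).eq, sub_parOf_mul_sub_parOf_neg h]
      exact ((((h.comm i).pow_right 2).sub_right ((h.comm i).smul_right _))).add_right
        (Algebra.commute_algebraMap_right _ _)
    have : c = Ring.inverse ((σ - parOf (-E) x) * (σ - parOf E x)) := by
      rw [Ring.mul_inverse_rev' (commute_sub_parOf h x).symm]; rfl
    rw [this]
    obtain ⟨u, hu'⟩ := hv.mul hu
    rw [← hu'] at hq ⊢
    rw [Ring.inverse_unit]
    exact hq.units_inv_right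
  have e1 : res E σ x = (σ - parOf (-E) x) * c := by
    rw [hc, (commute_res h x).eq, ← mul_assoc, res, res, Ring.mul_inverse_cancel _ hv, one_mul]
  have e2 : res (-E) σ x = (σ - parOf E x) * c := by
    rw [hc, ← mul_assoc, res, res, Ring.mul_inverse_cancel _ hu, one_mul]
  refine ⟨(σ - algebraMap ℝ A (x 0)) * c, c, fun i => ?_, hce, ?_, ?_⟩
  · exact ((h.comm i).sub_right (Algebra.commute_algebraMap_right _ _)).mul_right (hce i)
  · rw [e1, parOf_neg]; noncomm_ring
  · rw [e2, parOf_eq_add]; noncomm_ring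

end Algebra
end Abstract
end FineStructure

end

noncomputable section

namespace FineStructure

open scoped Laplacian
open Filter Topology

/-! ### Directional derivatives of resolvents and the Laplacian -/

section Derivatives

variable {A : Type*} [NormedRing A] [NormedAlgebra ℝ A]
variable {V : Type*} [NormedAddCommGroup V] [NormedSpace ℝ V]

/-- The coordinate direction `i`. -/
abbrev dir (i : Fin 6) : E6 := EuclideanSpace.single i 1

theorem hasLineDerivAt_mul {F G : E6 → A} {F' G' : A} {x v : E6}
    (hF : HasLineDerivAt ℝ F F' x v) (hG : HasLineDerivAt ℝ G G' x v) :
    HasLineDerivAt ℝ (fun y => F y * G y) (F' * G x + F x * G') x v := by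
  have := HasDerivAt.mul (c := fun t : ℝ => F (x + t • v)) (d := fun t : ℝ => G (x + t • v)) hF hG
  simpa [HasLineDerivAt, Pi.mul_def] using this

theorem hasLineDerivAt_add {F G : E6 → V} {F' G' : V} {x v : E6}
    (hF : HasLineDerivAt ℝ F F' x v) (hG : HasLineDerivAt ℝ G G' x v) :
    HasLineDerivAt ℝ (fun y => F y + G y) (F' + G') x v :=
  HasDerivAt.add hF hG

theorem hasLineDerivAt_const_smul {F : E6 → V} {F' : V} {x v : E6} (c : ℝ)
    (hF : HasLineDerivAt ℝ F F' x v) : HasLineDerivAt ℝ (fun y => c • F y) (c • F') x v :=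
  HasDerivAt.const_smul c hF

theorem hasLineDerivAt_mul_const {F : E6 → A} {F' : A} {x v : E6}
    (hF : HasLineDerivAt ℝ F F' x v) (c : A) :
    HasLineDerivAt ℝ (fun y => F y * c) (F' * c) x v :=
  HasDerivAt.mul_const hF c

theorem hasLineDerivAt_clm_apply {F : E6 → V →L[ℝ] V} {F' : V →L[ℝ] V} {x v : E6}
    (hF : HasLineDerivAt ℝ F F' x v) (w : V) :
    HasLineDerivAt ℝ (fun y => F y w) (F' w) x v :=
  ((ContinuousLinearMap.apply ℝ V w).hasFDerivAt.comp_hasDerivAt (0 : ℝ) hF :)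

theorem parOf_add_smul_dir (E : Fin 5 → A) (x : E6) (t : ℝ) (i : Fin 6) :
    parOf E (x + t • dir i) = parOf E x + t • unitOf E i := by
  simp only [parOf_eq_sum, PiLp.add_apply, PiLp.smul_apply, PiLp.single_apply, add_smul,
    Finset.sum_add_distrib, smul_eq_mul, mul_ite, mul_one, mul_zero, ite_smul, zero_smul,
    Finset.sum_ite_eq', Finset.mem_univ, if_true]

theorem contDiff_parOf (E : Fin 5 → A) {n : WithTop ℕ∞} : ContDiff ℝ n (parOf E) := by
  have : parOf E = fun x : E6 => ∑ i : Fin 6, x i • unitOf E i := funext (parOf_eq_sum E)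
  rw [this]
  fun_prop

variable [CompleteSpace A] {E : Fin 5 → A} {σ : A}

/-- The derivative of inversion is `-u⁻¹ (du) u⁻¹`, and here `du = -eᵢ`; the two signs cancel. -/
theorem hasLineDerivAt_res {x : E6} (hu : IsUnit (σ - parOf E x)) (i : Fin 6) :
    HasLineDerivAt ℝ (res E σ) (res E σ x * unitOf E i * res E σ x) x (dir i) := by
  obtain ⟨u, hu⟩ := hu
  have h1 : HasDerivAt (fun t : ℝ => σ - parOf E (x + t • dir i)) (-unitOf E i) 0 := by
    simp only [parOf_add_smul_dir]
    simpa using (((hasDerivAt_id (0 : ℝ)).smul_const (unitOf E i)).const_add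
      (parOf E x)).const_sub σ
  have h2 := hasFDerivAt_ringInverse (𝕜 := ℝ) u
  have h3 : (u : A) = (fun t : ℝ => σ - parOf E (x + t • dir i)) 0 := by simp [hu]
  rw [h3] at h2
  have h4 := h2.comp_hasDerivAt (0 : ℝ) h1
  have h5 : res E σ x = (↑u⁻¹ : A) := by rw [res, ← hu, Ring.inverse_unit]
  rw [h5]
  have h6 : HasDerivAt (Ring.inverse ∘ fun t : ℝ => σ - parOf E (x + t • dir i))
      (↑u⁻¹ * unitOf E i * ↑u⁻¹) 0 := by simpa using h4
  exact h6

theorem contDiffAt_res {x : E6} (hu : IsUnit (σ - parOf E x)) {n : WithTop ℕ∞} :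
    ContDiffAt ℝ n (res E σ) x := by
  obtain ⟨u, hu⟩ := hu
  have h2 := contDiffAt_ringInverse (n := n) ℝ u
  rw [hu] at h2
  exact h2.comp x (contDiff_const.sub (contDiff_parOf E)).contDiffAt

/-- `G i` must be the derivative on a whole neighbourhood: there it agrees with `fderiv ℝ f · (dir
i)`, so its derivative at `x` is the second derivative of `f`. -/
theorem laplacian_eq_of_hasLineDerivAt {f : E6 → V} {G : Fin 6 → E6 → V} {H : Fin 6 → V} {x : E6}
    (hf : ContDiffAt ℝ 2 f x)
    (hG : ∀ᶠ y in 𝓝 x, ∀ i, HasLineDerivAt ℝ f (G i y) y (dir i))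
    (hH : ∀ i, HasLineDerivAt ℝ (G i) (H i) x (dir i)) : Δ f x = ∑ i, H i := by
  rw [InnerProductSpace.laplacian_eq_iteratedFDeriv_orthonormalBasis f
    (EuclideanSpace.basisFun (Fin 6) ℝ)]
  refine Finset.sum_congr rfl fun i _ => ?_
  rw [iteratedFDeriv_two_apply]
  simp only [EuclideanSpace.basisFun_apply, Matrix.cons_val_zero, Matrix.cons_val_one]
  have hd : DifferentiableAt ℝ (fderiv ℝ f) x :=
    (hf.fderiv_right (m := 1) (by norm_num)).differentiableAt (by norm_num)
  have h1 : HasLineDerivAt ℝ (fun y => fderiv ℝ f y (dir i))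
      (fderiv ℝ (fderiv ℝ f) x (dir i) (dir i)) x (dir i) := by
    have h0 := (hd.hasFDerivAt.clm_apply (hasFDerivAt_const (dir i) x)).hasLineDerivAt (dir i)
    simpa using h0
  have h2 : G i =ᶠ[𝓝 x] fun y => fderiv ℝ f y (dir i) := by
    filter_upwards [hG, hf.eventually (by simp)] with y hy hy'
    exact (hy i).unique ((hy'.differentiableAt (by simp)).hasFDerivAt.hasLineDerivAt _)
  exact h1.unique ((hH i).congr_of_eventuallyEq h2.symm)

end Derivatives

/-! ### Evaluating the sandwich sums on monomials in `p` and `r` -/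

section SumIdentities

variable {A : Type*} [NormedRing A] [NormedAlgebra ℝ A] {E : Fin 5 → A} {σ p r : A} {x : E6}

theorem sum_dirac_p (h : IsCliffordFamily E σ) (hp : ConjPair E x p r) :
    ∑ i, unitOf E i * (p * unitOf E i * p) = -(4 : ℝ) • (r * p) := by
  rw [← smul_mul_assoc, ← hp.sum_unit_unit h, Finset.sum_mul]
  exact Finset.sum_congr rfl fun i _ => by noncomm_ring

theorem sum_diracBar_p (h : IsCliffordFamily E σ) (hp : ConjPair E x p r) :
    ∑ i, unitOf (-E) i * (p * unitOf E i * p) = (2 : ℝ) • (p * p) + (4 : ℝ) • (r * p) := by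
  rw [← smul_mul_assoc, ← smul_mul_assoc, ← add_mul, ← hp.sum_neg_unit h, Finset.sum_mul]
  exact Finset.sum_congr rfl fun i _ => by noncomm_ring

theorem sum_dirac_pr (h : IsCliffordFamily E σ) (hp : ConjPair E x p r) (hc : r * p = p * r) :
    ∑ i, unitOf E i * (p * unitOf E i * p * r + p * (r * unitOf (-E) i * r)) =
      (2 : ℝ) • (p * (r * r)) := by
  have hc' : ∀ z, r * (p * z) = p * (r * z) := fun z => by rw [← mul_assoc, hc, mul_assoc]
  have e : ∑ i, unitOf E i * (p * unitOf E i * p * r + p * (r * unitOf (-E) i * r)) =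
      (∑ i, unitOf E i * p * unitOf E i) * (p * r) +
        (∑ i, unitOf E i * (p * r) * unitOf (-E) i) * r := by
    simp only [Finset.sum_mul, ← Finset.sum_add_distrib]
    exact Finset.sum_congr rfl fun i _ => by noncomm_ring
  -- `p r` is its own conjugate, so its sandwich contributes `2 + 4 = 6`; with the `-4` of the first
  -- sum this leaves `2`.
  rw [e, hp.sum_unit_unit h, (hp.mul h hp.symm).sum_unit_neg h]
  simp only [smul_mul_assoc, add_mul, mul_assoc, hc, hc']
  module

theorem sum_diracBar_pr (h : IsCliffordFamily E σ) (hp : ConjPair E x p r) (hc : r * p = p * r) :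
    ∑ i, unitOf (-E) i * (p * unitOf E i * p * r + p * (r * unitOf (-E) i * r)) =
      (2 : ℝ) • (p * (p * r)) := by
  have hc' : ∀ z, r * (p * z) = p * (r * z) := fun z => by rw [← mul_assoc, hc, mul_assoc]
  have e : ∑ i, unitOf (-E) i * (p * unitOf E i * p * r + p * (r * unitOf (-E) i * r)) =
      (∑ i, unitOf (-E) i * p * unitOf E i) * (p * r) +
        (∑ i, unitOf (-E) i * (p * r) * unitOf (-E) i) * r := by
    simp only [Finset.sum_mul, ← Finset.sum_add_distrib]
    exact Finset.sum_congr rfl fun i _ => by noncomm_ring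
  rw [e, hp.sum_neg_unit h, (hp.mul h hp.symm).sum_neg_neg h]
  simp only [smul_mul_assoc, add_mul, mul_assoc, hc, hc']
  module

theorem sum_diracBar_pp (h : IsCliffordFamily E σ) (hp : ConjPair E x p r) (hc : r * p = p * r) :
    ∑ i, unitOf (-E) i * (p * unitOf E i * p * p + p * (p * unitOf E i * p)) =
      (4 : ℝ) • (p * (p * p)) + (4 : ℝ) • (p * (p * r)) + (4 : ℝ) • (p * (r * r)) := by
  have hc' : ∀ z, r * (p * z) = p * (r * z) := fun z => by rw [← mul_assoc, hc, mul_assoc]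
  have e : ∑ i, unitOf (-E) i * (p * unitOf E i * p * p + p * (p * unitOf E i * p)) =
      (∑ i, unitOf (-E) i * p * unitOf E i) * (p * p) +
        (∑ i, unitOf (-E) i * (p * p) * unitOf E i) * p := by
    simp only [Finset.sum_mul, ← Finset.sum_add_distrib]
    exact Finset.sum_congr rfl fun i _ => by noncomm_ring
  rw [e, hp.sum_neg_unit h, (hp.mul h hp).sum_neg_unit h]
  simp only [smul_mul_assoc, add_mul, mul_assoc, hc, hc']
  module

theorem sum_diracBar_ppr (h : IsCliffordFamily E σ) (hp : ConjPair E x p r)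
    (hc : r * p = p * r) :
    ∑ i, unitOf (-E) i * (p * unitOf E i * p * (p * r) +
        p * (p * unitOf E i * p * r + p * (r * unitOf (-E) i * r))) =
      (4 : ℝ) • (p * (p * (p * r))) + (4 : ℝ) • (p * (p * (r * r))) := by
  have hc' : ∀ z, r * (p * z) = p * (r * z) := fun z => by rw [← mul_assoc, hc, mul_assoc]
  have e : ∑ i, unitOf (-E) i * (p * unitOf E i * p * (p * r) +
        p * (p * unitOf E i * p * r + p * (r * unitOf (-E) i * r))) =
      (∑ i, unitOf (-E) i * p * unitOf E i) * (p * (p * r)) +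
        (∑ i, unitOf (-E) i * (p * p) * unitOf E i) * (p * r) +
        (∑ i, unitOf (-E) i * (p * p * r) * unitOf (-E) i) * r := by
    simp only [Finset.sum_mul, ← Finset.sum_add_distrib]
    exact Finset.sum_congr rfl fun i _ => by noncomm_ring
  rw [e, hp.sum_neg_unit h, (hp.mul h hp).sum_neg_unit h,
    ((hp.mul h hp).mul h hp.symm).sum_neg_neg h]
  simp only [smul_mul_assoc, add_mul, mul_assoc, hc, hc']
  module

theorem sum_laplacian_p (h : IsCliffordFamily E σ) (hp : ConjPair E x p r) (hc : r * p = p * r) :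
    ∑ i, (p * unitOf E i * p * unitOf E i * p + p * unitOf E i * (p * unitOf E i * p)) =
      -(8 : ℝ) • (p * (p * r)) := by
  have e : ∑ i, (p * unitOf E i * p * unitOf E i * p + p * unitOf E i * (p * unitOf E i * p)) =
      p * (∑ i, unitOf E i * p * unitOf E i) * p + p * (∑ i, unitOf E i * p * unitOf E i) * p := by
    simp only [Finset.mul_sum, Finset.sum_mul, ← Finset.sum_add_distrib]
    exact Finset.sum_congr rfl fun i _ => by noncomm_ring
  rw [e, hp.sum_unit_unit h]
  simp only [smul_mul_assoc, mul_smul_comm, mul_assoc, hc]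
  module

theorem sum_laplacian_pp (h : IsCliffordFamily E σ) (hp : ConjPair E x p r)
    (hc : r * p = p * r) :
    ∑ i, ((p * unitOf E i * p * unitOf E i * p + p * unitOf E i * (p * unitOf E i * p)) * p +
        p * unitOf E i * p * (p * unitOf E i * p) + (p * unitOf E i * p * (p * unitOf E i * p) +
        p * (p * unitOf E i * p * unitOf E i * p + p * unitOf E i * (p * unitOf E i * p)))) =
      -(16 : ℝ) • (p * (p * (p * r))) - (8 : ℝ) • (p * (p * (r * r))) := by
  have hc' : ∀ z, r * (p * z) = p * (r * z) := fun z => by rw [← mul_assoc, hc, mul_assoc]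
  have e : ∑ i, ((p * unitOf E i * p * unitOf E i * p + p * unitOf E i * (p * unitOf E i * p)) * p +
        p * unitOf E i * p * (p * unitOf E i * p) + (p * unitOf E i * p * (p * unitOf E i * p) +
        p * (p * unitOf E i * p * unitOf E i * p + p * unitOf E i * (p * unitOf E i * p)))) =
      (2 : ℝ) • (p * (∑ i, unitOf E i * p * unitOf E i) * (p * p)) +
      (2 : ℝ) • (p * (∑ i, unitOf E i * (p * p) * unitOf E i) * p) +
      (2 : ℝ) • (p * p * (∑ i, unitOf E i * p * unitOf E i) * p) := by
    simp only [Finset.mul_sum, Finset.sum_mul, Finset.smul_sum, ← Finset.sum_add_distrib]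
    exact Finset.sum_congr rfl fun i _ => by
      simp only [two_smul]
      noncomm_ring
  -- The outer sums give `-8 p³r` each; the mixed one, sandwiching `p²` with conjugate `r²`, gives
  -- `-8 p²r²`.
  rw [e, hp.sum_unit_unit h, (hp.mul h hp).sum_unit_unit h]
  simp only [smul_mul_assoc, mul_smul_comm, mul_assoc, hc, hc']
  module

theorem sum_laplacian_pr (h : IsCliffordFamily E σ) (hp : ConjPair E x p r)
    (hc : r * p = p * r) :
    ∑ i, ((p * unitOf E i * p * unitOf E i * p + p * unitOf E i * (p * unitOf E i * p)) * r +
        p * unitOf E i * p * (r * unitOf (-E) i * r) +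
        (p * unitOf E i * p * (r * unitOf (-E) i * r) +
        p * (r * unitOf (-E) i * r * unitOf (-E) i * r +
          r * unitOf (-E) i * (r * unitOf (-E) i * r)))) =
      -(4 : ℝ) • (p * (p * (r * r))) := by
  have hc' : ∀ z, r * (p * z) = p * (r * z) := fun z => by rw [← mul_assoc, hc, mul_assoc]
  have e : ∑ i, ((p * unitOf E i * p * unitOf E i * p +
          p * unitOf E i * (p * unitOf E i * p)) * r +
        p * unitOf E i * p * (r * unitOf (-E) i * r) +
        (p * unitOf E i * p * (r * unitOf (-E) i * r) +
        p * (r * unitOf (-E) i * r * unitOf (-E) i * r +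
          r * unitOf (-E) i * (r * unitOf (-E) i * r)))) =
      (2 : ℝ) • (p * (∑ i, unitOf E i * p * unitOf E i) * (p * r)) +
      (2 : ℝ) • (p * (∑ i, unitOf E i * (p * r) * unitOf (-E) i) * r) +
      (2 : ℝ) • (p * r * (∑ i, unitOf (-E) i * r * unitOf (-E) i) * r) := by
    simp only [Finset.mul_sum, Finset.sum_mul, Finset.smul_sum, ← Finset.sum_add_distrib]
    exact Finset.sum_congr rfl fun i _ => by
      simp only [two_smul]
      noncomm_ring
  -- The three terms of the Leibniz rule contribute `-8`, `12` and `-8` times `p²r²`.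
  rw [e, hp.sum_unit_unit h, (hp.mul h hp.symm).sum_unit_neg h, hp.symm.sum_neg_neg h]
  simp only [smul_mul_assoc, mul_smul_comm, mul_add, add_mul, mul_assoc, hc, hc']
  module

end SumIdentities
end FineStructure

end

noncomputable section

namespace FineStructure

open scoped Laplacian
open Filter Topology

/-! ### The differential operators applied to a vector value of the resolvent -/

section Kernels

variable {V : Type*} [NormedAddCommGroup V] [NormedSpace ℝ V]

/-- The Dirac operator whose imaginary units are the operators `E i`. -/
def diracOf (E : Fin 5 → V →L[ℝ] V) (f : E6 → V) (x : E6) : V :=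
  lineDeriv ℝ f x (dir 0) + ∑ i : Fin 5, E i (lineDeriv ℝ f x (dir i.succ))

/-- Units and derivatives both act as operators on values, so the Dirac operator becomes an identity
in the operator algebra, evaluated at the fixed vector `v`. -/
theorem diracOf_eq {E : Fin 5 → V →L[ℝ] V} {W : Set E6} (hW : IsOpen W) {f : E6 → V} {v : V}
    {F : E6 → V →L[ℝ] V} {G : Fin 6 → V →L[ℝ] V} {x : E6} (hx : x ∈ W)
    (hf : ∀ y ∈ W, f y = F y v) (hG : ∀ i, HasLineDerivAt ℝ F (G i) x (dir i)) :
    diracOf E f x = (∑ i, unitOf E i * G i) v := by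
  have key : ∀ i, lineDeriv ℝ f x (dir i) = G i v := fun i => by
    refine HasLineDerivAt.lineDeriv ((hasLineDerivAt_clm_apply (hG i) v).congr_of_eventuallyEq ?_)
    filter_upwards [hW.mem_nhds hx] with y hy using hf y hy
  rw [diracOf, Fin.sum_univ_succ (n := 5)]
  simp only [key, unitOf, Fin.cons_zero, Fin.cons_succ, one_mul, add_apply, sum_apply]
  rfl

theorem laplacian_eq {W : Set E6} (hW : IsOpen W) {f : E6 → V} {v : V}
    {F : E6 → V →L[ℝ] V} {G : Fin 6 → E6 → V →L[ℝ] V} {H : Fin 6 → V →L[ℝ] V} {x : E6}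
    (hx : x ∈ W) (hf : ∀ y ∈ W, f y = F y v) (hF : ContDiffAt ℝ 2 F x)
    (hG : ∀ y ∈ W, ∀ i, HasLineDerivAt ℝ F (G i y) y (dir i))
    (hH : ∀ i, HasLineDerivAt ℝ (G i) (H i) x (dir i)) :
    Δ f x = (∑ i, H i) v := by
  have hfx : f =ᶠ[𝓝 x] fun y => F y v := by
    filter_upwards [hW.mem_nhds hx] with y hy using hf y hy
  rw [(InnerProductSpace.laplacian_congr_nhds hfx).eq_of_nhds, sum_apply]
  refine laplacian_eq_of_hasLineDerivAt (G := fun i y => G i y v) (hF.clm_apply contDiffAt_const)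
    ?_ fun i => hasLineDerivAt_clm_apply (hH i) v
  filter_upwards [hW.mem_nhds hx] with y hy i using hasLineDerivAt_clm_apply (hG y hy i) v

variable {E : Fin 5 → V →L[ℝ] V} {σ : V →L[ℝ] V} {W : Set E6} {f : E6 → V}
  {v : V} {x : E6}

/-- On the open set `W`, `σ - x` and `σ - x̄` are invertible. -/
structure IsResolventSet (E : Fin 5 → V →L[ℝ] V) (σ : V →L[ℝ] V) (W : Set E6) : Prop where
  family : IsCliffordFamily E σ
  isOpen : IsOpen W
  isUnit : ∀ y ∈ W, IsUnit (σ - parOf E y)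
  isUnit_neg : ∀ y ∈ W, IsUnit (σ - parOf (-E) y)

namespace IsResolventSet

theorem conjPair (h : IsResolventSet E σ W) (hx : x ∈ W) : ConjPair E x (res E σ x) (res (-E) σ x) :=
  conjPair_res h.family (h.isUnit x hx) (h.isUnit_neg x hx)

variable [CompleteSpace V]

theorem deriv_p (h : IsResolventSet E σ W) (hx : x ∈ W) (i : Fin 6) :
    HasLineDerivAt ℝ (res E σ) (res E σ x * unitOf E i * res E σ x) x (dir i) :=
  hasLineDerivAt_res (h.isUnit x hx) i

theorem deriv_r (h : IsResolventSet E σ W) (hx : x ∈ W) (i : Fin 6) :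
    HasLineDerivAt ℝ (res (-E) σ) (res (-E) σ x * unitOf (-E) i * res (-E) σ x) x (dir i) :=
  hasLineDerivAt_res (h.isUnit_neg x hx) i

theorem contDiffAt_p (h : IsResolventSet E σ W) (hx : x ∈ W) : ContDiffAt ℝ 2 (res E σ) x := contDiffAt_res (h.isUnit x hx)

theorem contDiffAt_r (h : IsResolventSet E σ W) (hx : x ∈ W) : ContDiffAt ℝ 2 (res (-E) σ) x := contDiffAt_res (h.isUnit_neg x hx)

theorem deriv_pr (h : IsResolventSet E σ W) (hx : x ∈ W) (i : Fin 6) :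
    HasLineDerivAt ℝ (fun y => res E σ y * res (-E) σ y)
      (res E σ x * unitOf E i * res E σ x * res (-E) σ x +
        res E σ x * (res (-E) σ x * unitOf (-E) i * res (-E) σ x)) x (dir i) :=
  hasLineDerivAt_mul (h.deriv_p hx i) (h.deriv_r hx i)

theorem deriv_pp (h : IsResolventSet E σ W) (hx : x ∈ W) (i : Fin 6) :
    HasLineDerivAt ℝ (fun y => res E σ y * res E σ y)
      (res E σ x * unitOf E i * res E σ x * res E σ x +
        res E σ x * (res E σ x * unitOf E i * res E σ x)) x (dir i) :=
  hasLineDerivAt_mul (h.deriv_p hx i) (h.deriv_p hx i)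

theorem deriv_pep (h : IsResolventSet E σ W) (hx : x ∈ W) (i : Fin 6) :
    HasLineDerivAt ℝ (fun y => res E σ y * unitOf E i * res E σ y)
      (res E σ x * unitOf E i * res E σ x * unitOf E i * res E σ x +
        res E σ x * unitOf E i * (res E σ x * unitOf E i * res E σ x)) x (dir i) :=
  hasLineDerivAt_mul (hasLineDerivAt_mul_const (h.deriv_p hx i) (unitOf E i)) (h.deriv_p hx i)

theorem deriv_rer (h : IsResolventSet E σ W) (hx : x ∈ W) (i : Fin 6) :
    HasLineDerivAt ℝ (fun y => res (-E) σ y * unitOf (-E) i * res (-E) σ y)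
      (res (-E) σ x * unitOf (-E) i * res (-E) σ x * unitOf (-E) i * res (-E) σ x +
        res (-E) σ x * unitOf (-E) i * (res (-E) σ x * unitOf (-E) i * res (-E) σ x)) x (dir i) :=
  hasLineDerivAt_mul (hasLineDerivAt_mul_const (h.deriv_r hx i) (unitOf (-E) i)) (h.deriv_r hx i)

theorem diracOf_eq_smul_pr (h : IsResolventSet E σ W) (hx : x ∈ W)
    (hf : ∀ y ∈ W, f y = res E σ y v) :
    diracOf E f x = (-(4 : ℝ) • (res E σ x * res (-E) σ x)) v := by
  rw [diracOf_eq h.isOpen hx hf (h.deriv_p hx), sum_dirac_p h.family (h.conjPair hx),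
    (commute_res h.family x).eq]

theorem diracOf_neg_eq (h : IsResolventSet E σ W) (hx : x ∈ W)
    (hf : ∀ y ∈ W, f y = res E σ y v) :
    diracOf (-E) f x =
      ((2 : ℝ) • (res E σ x * res E σ x) + (4 : ℝ) • (res E σ x * res (-E) σ x)) v := by
  rw [diracOf_eq h.isOpen hx hf (h.deriv_p hx), sum_diracBar_p h.family (h.conjPair hx),
    (commute_res h.family x).eq]

theorem laplacian_eq_smul_ppr (h : IsResolventSet E σ W) (hx : x ∈ W)
    (hf : ∀ y ∈ W, f y = res E σ y v) :
    Δ f x = (-(8 : ℝ) • (res E σ x * (res E σ x * res (-E) σ x))) v := by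
  rw [laplacian_eq h.isOpen hx hf (h.contDiffAt_p hx) (fun y hy => h.deriv_p hy)
    (h.deriv_pep hx), sum_laplacian_p h.family (h.conjPair hx) (commute_res h.family x).symm.eq]

theorem diracOf_diracOf_eq (h : IsResolventSet E σ W) (hx : x ∈ W)
    (hf : ∀ y ∈ W, f y = res E σ y v) :
    diracOf E (diracOf E f) x =
      (-(8 : ℝ) • (res E σ x * (res (-E) σ x * res (-E) σ x))) v := by
  rw [diracOf_eq h.isOpen hx (fun y hy => h.diracOf_eq_smul_pr hy hf)
    fun i => hasLineDerivAt_const_smul _ (h.deriv_pr hx i)]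
  simp only [mul_smul_comm, ← Finset.smul_sum]
  rw [sum_dirac_pr h.family (h.conjPair hx) (commute_res h.family x).symm.eq]
  congr 1
  module

theorem laplacian_diracOf_eq (h : IsResolventSet E σ W) (hx : x ∈ W)
    (hf : ∀ y ∈ W, f y = res E σ y v) :
    Δ (diracOf E f) x =
      ((16 : ℝ) • (res E σ x * (res E σ x * (res (-E) σ x * res (-E) σ x)))) v := by
  rw [laplacian_eq h.isOpen hx (fun y hy => h.diracOf_eq_smul_pr hy hf)
    (((h.contDiffAt_p hx).mul (h.contDiffAt_r hx)).const_smul _)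
    (fun y hy i => hasLineDerivAt_const_smul _ (h.deriv_pr hy i))
    fun i => hasLineDerivAt_const_smul _ (hasLineDerivAt_add
      (hasLineDerivAt_mul (h.deriv_pep hx i) (h.deriv_r hx i))
      (hasLineDerivAt_mul (h.deriv_p hx i) (h.deriv_rer hx i)))]
  rw [← Finset.smul_sum,
    sum_laplacian_pr h.family (h.conjPair hx) (commute_res h.family x).symm.eq]
  congr 1
  module

theorem diracOf_neg_diracOf_neg_eq (h : IsResolventSet E σ W) (hx : x ∈ W)
    (hf : ∀ y ∈ W, f y = res E σ y v) :
    diracOf (-E) (diracOf (-E) f) x =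
      ((8 : ℝ) • (res E σ x * (res E σ x * res E σ x)) +
        (16 : ℝ) • (res E σ x * (res E σ x * res (-E) σ x)) +
        (8 : ℝ) • (res E σ x * (res (-E) σ x * res (-E) σ x))) v := by
  rw [diracOf_eq h.isOpen hx (fun y hy => h.diracOf_neg_eq hy hf)
    fun i => hasLineDerivAt_add (hasLineDerivAt_const_smul _ (h.deriv_pp hx i))
      (hasLineDerivAt_const_smul _ (h.deriv_pr hx i))]
  simp only [mul_add (unitOf (-E) _) (_ • _), mul_smul_comm, ← Finset.smul_sum,
    Finset.sum_add_distrib]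
  rw [sum_diracBar_pp h.family (h.conjPair hx) (commute_res h.family x).symm.eq,
    sum_diracBar_pr h.family (h.conjPair hx) (commute_res h.family x).symm.eq]
  congr 1
  module

theorem laplacian_diracOf_neg_eq (h : IsResolventSet E σ W) (hx : x ∈ W)
    (hf : ∀ y ∈ W, f y = res E σ y v) :
    Δ (diracOf (-E) f) x =
      (-(32 : ℝ) • (res E σ x * (res E σ x * (res E σ x * res (-E) σ x))) -
        (32 : ℝ) • (res E σ x * (res E σ x * (res (-E) σ x * res (-E) σ x)))) v := by
  rw [laplacian_eq h.isOpen hx (fun y hy => h.diracOf_neg_eq hy hf)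
    ((((h.contDiffAt_p hx).mul (h.contDiffAt_p hx)).const_smul _).add
      (((h.contDiffAt_p hx).mul (h.contDiffAt_r hx)).const_smul _))
    (fun y hy i => hasLineDerivAt_add (hasLineDerivAt_const_smul _ (h.deriv_pp hy i))
      (hasLineDerivAt_const_smul _ (h.deriv_pr hy i)))
    fun i => hasLineDerivAt_add
      (hasLineDerivAt_const_smul _ (hasLineDerivAt_add
        (hasLineDerivAt_mul (h.deriv_pep hx i) (h.deriv_p hx i))
        (hasLineDerivAt_mul (h.deriv_p hx i) (h.deriv_pep hx i))))
      (hasLineDerivAt_const_smul _ (hasLineDerivAt_add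
        (hasLineDerivAt_mul (h.deriv_pep hx i) (h.deriv_r hx i))
        (hasLineDerivAt_mul (h.deriv_p hx i) (h.deriv_rer hx i))))]
  -- From `D̄ p = 2p² + 4pr`: the `p³r` coefficient is `2·(-16)`, the `p²r²` coefficient `2·(-8) +
  -- 4·(-4)`.
  rw [Finset.sum_add_distrib, ← Finset.smul_sum, ← Finset.smul_sum,
    sum_laplacian_pp h.family (h.conjPair hx) (commute_res h.family x).symm.eq,
    sum_laplacian_pr h.family (h.conjPair hx) (commute_res h.family x).symm.eq]
  congr 1
  module

/-- The right `ΔD̄` kernel applies `Δ` before `D̄`, so this order is computed directly, without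
commuting the operators. -/
theorem diracOf_neg_laplacian_eq (h : IsResolventSet E σ W) (hx : x ∈ W)
    (hf : ∀ y ∈ W, f y = res E σ y v) :
    diracOf (-E) (Δ f) x =
      (-(32 : ℝ) • (res E σ x * (res E σ x * (res E σ x * res (-E) σ x))) -
        (32 : ℝ) • (res E σ x * (res E σ x * (res (-E) σ x * res (-E) σ x)))) v := by
  rw [diracOf_eq h.isOpen hx (fun y hy => h.laplacian_eq_smul_ppr hy hf)
    fun i => hasLineDerivAt_const_smul _
      (hasLineDerivAt_mul (h.deriv_p hx i) (h.deriv_pr hx i))]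
  simp only [mul_smul_comm, ← Finset.smul_sum]
  rw [sum_diracBar_ppr h.family (h.conjPair hx) (commute_res h.family x).symm.eq]
  congr 1
  module

end IsResolventSet
end Kernels
end FineStructure

end

noncomputable section

namespace FineStructure

open Filter Topology Finset

/-! ### Neumann series and Cauchy products -/

section Series

variable {A : Type*} [NormedRing A]

/-- `f` is absolutely summable with sum `F`. -/
def HasAbsSum (f : ℕ → A) (F : A) : Prop := (Summable fun n => ‖f n‖) ∧ HasSum f F

theorem HasAbsSum.mul [CompleteSpace A] {f g : ℕ → A} {F G : A} (hf : HasAbsSum f F)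
    (hg : HasAbsSum g G) :
    HasAbsSum (fun n => ∑ kl ∈ antidiagonal n, f kl.1 * g kl.2) (F * G) := by
  have hs := summable_norm_sum_mul_antidiagonal_of_summable_norm hf.1 hg.1
  refine ⟨hs, ?_⟩
  rw [← hf.2.tsum_eq, ← hg.2.tsum_eq,
    tsum_mul_tsum_eq_tsum_sum_antidiagonal_of_summable_norm hf.1 hg.1]
  exact hs.of_norm.hasSum

theorem hasSum_of_forall_eq {V : Type*} [AddCommMonoid V] [TopologicalSpace V]
    {f g : ℕ → V} {F : V} (hf : HasSum f F) (h : ∀ n, g n = f n) :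
    HasSum g F :=
  (funext h : g = f) ▸ hf

theorem sum_antidiagonal_eq_sum_Icc {M : Type*} [AddCommMonoid M] (g : ℕ → ℕ → M) (n : ℕ) :
    ∑ kl ∈ antidiagonal n, g kl.1 kl.2 = ∑ k ∈ Icc 1 (n + 1), g (n + 1 - k) (k - 1) := by
  refine sum_bij' (fun kl _ => kl.2 + 1) (fun k _ => (n + 1 - k, k - 1)) ?_ ?_ ?_ ?_ ?_
  · rintro ⟨k, l⟩ h
    simp only [HasAntidiagonal.mem_antidiagonal, mem_Icc] at h ⊢
    omega
  · intro k h
    simp only [HasAntidiagonal.mem_antidiagonal, mem_Icc] at h ⊢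
    omega
  · rintro ⟨k, l⟩ h
    simp only [HasAntidiagonal.mem_antidiagonal, Prod.mk.injEq] at h ⊢
    omega
  · intro k h
    simp only [mem_Icc] at h ⊢
    omega
  · rintro ⟨k, l⟩ h
    simp only [HasAntidiagonal.mem_antidiagonal] at h ⊢
    congr 1; omega

/-- With `S` the sum, shifting the index gives `σ S = 1 + a S`; `S` commutes with `σ - a`, so it is
a two-sided inverse. Summability replaces a bound `‖a σ⁻¹‖ < 1`, which may fail for the chosen norm.
-/
theorem hasAbsSum_resolvent [CompleteSpace A] {a σ : A} (hσ : IsUnit σ) (hc : Commute a σ)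
    (hs : Summable fun n : ℕ => ‖a ^ n * Ring.inverse σ ^ (n + 1)‖) :
    IsUnit (σ - a) ∧
      HasAbsSum (fun n => a ^ n * Ring.inverse σ ^ (n + 1)) (Ring.inverse (σ - a)) := by
  obtain ⟨u, rfl⟩ := hσ
  rw [Ring.inverse_unit] at hs ⊢
  have hcu : Commute a (↑u⁻¹ : A) := hc.units_inv_right
  set f : ℕ → A := fun n => a ^ n * (↑u⁻¹ : A) ^ (n + 1) with hf
  have hsum : Summable f := hs.of_norm
  have h1 : (u : A) * ∑' n, f n = 1 + a * ∑' n, f n := by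
    rw [← hsum.tsum_mul_left, ← hsum.tsum_mul_left, (hsum.mul_left (u : A)).tsum_eq_zero_add]
    congr 1
    · simp [hf]
    · refine tsum_congr fun n => ?_
      have : (u : A) * a ^ (n + 1) = a ^ (n + 1) * u := (hc.pow_left _).symm.eq
      simp only [hf]
      rw [← mul_assoc, this, pow_succ' (↑u⁻¹ : A) (n + 1), mul_assoc, Units.mul_inv_cancel_left,
        pow_succ' a, mul_assoc]
  have h2 : ((u : A) - a) * ∑' n, f n = 1 := by rw [sub_mul, h1, add_sub_cancel_right]
  have hcomm : Commute ((u : A) - a) (∑' n, f n) := by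
    refine Commute.tsum_right _ fun n => ?_
    refine Commute.sub_left ?_ ?_
    · exact (hc.symm.pow_right n).mul_right
        ((Commute.refl (u : A)).units_inv_right.pow_right (n + 1))
    · exact ((Commute.refl a).pow_right n).mul_right (hcu.pow_right (n + 1))
  let w : Aˣ := ⟨(u : A) - a, ∑' n, f n, h2, by rw [← hcomm.eq, h2]⟩
  have hw : Ring.inverse ((u : A) - a) = ∑' n, f n := Ring.inverse_unit w
  exact ⟨⟨w, rfl⟩, hs, hw ▸ hsum.hasSum⟩

variable [NormedAlgebra ℝ A]

theorem smul_mul_smul_powers {a b t : A} (hb : Commute b t) (c d : ℝ) (k l i j : ℕ) :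
    c • (a ^ k * t ^ (k + i)) * d • (b ^ l * t ^ (l + j)) =
      (c * d) • (a ^ k * b ^ l * t ^ (k + l + (i + j))) := by
  have : t ^ (k + i) * b ^ l = b ^ l * t ^ (k + i) := ((hb.pow_pow l (k + i)).symm).eq
  rw [smul_mul_smul_comm, mul_assoc, ← mul_assoc (t ^ _), this, mul_assoc, mul_assoc, ← pow_add]
  congr 4
  omega

variable {a b t P R : A} {i j : ℕ} {c d : ℕ → ℝ}

/-- The constant weight is kept as an unreduced function application so that it matches the pattern
`c n` of the product lemmas. -/
theorem HasAbsSum.one_smul_powers (hP : HasAbsSum (fun n => a ^ n * t ^ (n + 1)) P) :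
    HasAbsSum (fun n => (fun _ => (1 : ℝ)) n • (a ^ n * t ^ (n + 1))) P := by
  simpa only [one_smul] using hP

variable [CompleteSpace A]
-- Only `b` has to move past `t`: the factors `aᵏ` already stand on the left. The index `k` is one
-- more than the power of `b`.
theorem HasAbsSum.mul_powers (hb : Commute b t)
    (hP : HasAbsSum (fun n => c n • (a ^ n * t ^ (n + i))) P)
    (hR : HasAbsSum (fun n => d n • (b ^ n * t ^ (n + j))) R) :
    HasSum (fun n => ∑ k ∈ Icc 1 (n + 1), (c (n + 1 - k) * d (k - 1)) •
      (a ^ (n + 1 - k) * b ^ (k - 1) * t ^ (n + (i + j)))) (P * R) := by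
  have h := (hP.mul hR).2
  have e : ∀ n, ∑ kl ∈ antidiagonal n, c kl.1 • (a ^ kl.1 * t ^ (kl.1 + i)) *
      d kl.2 • (b ^ kl.2 * t ^ (kl.2 + j)) =
      ∑ k ∈ Icc 1 (n + 1), (c (n + 1 - k) * d (k - 1)) •
        (a ^ (n + 1 - k) * b ^ (k - 1) * t ^ (n + (i + j))) := fun n => by
    rw [← sum_antidiagonal_eq_sum_Icc fun k l => (c k * d l) • (a ^ k * b ^ l * t ^ (n + (i + j)))]
    refine sum_congr rfl fun kl hkl => ?_
    rw [smul_mul_smul_powers hb, HasAntidiagonal.mem_antidiagonal.1 hkl]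
  simpa only [e] using h

theorem HasAbsSum.mul_same_powers (ha : Commute a t)
    (hP : HasAbsSum (fun n => c n • (a ^ n * t ^ (n + i))) P)
    (hR : HasAbsSum (fun n => d n • (a ^ n * t ^ (n + j))) R) :
    HasAbsSum (fun n => (∑ kl ∈ antidiagonal n, c kl.1 * d kl.2) • (a ^ n * t ^ (n + (i + j))))
      (P * R) := by
  have h := hP.mul hR
  have e : ∀ n, ∑ kl ∈ antidiagonal n, c kl.1 • (a ^ kl.1 * t ^ (kl.1 + i)) *
      d kl.2 • (a ^ kl.2 * t ^ (kl.2 + j)) =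
      (∑ kl ∈ antidiagonal n, c kl.1 * d kl.2) • (a ^ n * t ^ (n + (i + j))) := fun n => by
    rw [sum_smul]
    refine sum_congr rfl fun kl hkl => ?_
    rw [smul_mul_smul_powers ha, ← pow_add, HasAntidiagonal.mem_antidiagonal.1 hkl]
  simpa only [e] using h

theorem HasAbsSum.sq_powers (ha : Commute a t)
    (hP : HasAbsSum (fun n => a ^ n * t ^ (n + 1)) P) :
    HasAbsSum (fun n => (fun n : ℕ => (n : ℝ) + 1) n • (a ^ n * t ^ (n + 2))) (P * P) := by
  have h := hP.one_smul_powers.mul_same_powers ha hP.one_smul_powers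
  simpa using h

theorem sum_antidiagonal_succ_snd (n : ℕ) :
    ∑ kl ∈ antidiagonal n, ((kl.2 : ℝ) + 1) = ((n : ℝ) + 1) * (n + 2) / 2 := by
  induction n with
  | zero => simp
  | succ n ih =>
    rw [Finset.Nat.sum_antidiagonal_succ, ih]
    push_cast
    ring

/-- Convolving the weights `1` with the weights `n + 1` of the square gives triangular numbers. -/
theorem HasAbsSum.cube_powers (ha : Commute a t)
    (hP : HasAbsSum (fun n => a ^ n * t ^ (n + 1)) P) :
    HasAbsSum (fun n => (fun n : ℕ => ((n : ℝ) + 1) * (n + 2) / 2) n • (a ^ n * t ^ (n + 3)))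
      (P * (P * P)) := by
  have h := hP.one_smul_powers.mul_same_powers ha (hP.sq_powers ha)
  simpa only [one_mul, sum_antidiagonal_succ_snd] using h

end Series

/-! ### Expansions of the monomials and of the kernels -/

section Expansions

variable {V : Type*} [NormedAddCommGroup V] [NormedSpace ℝ V]
  {a b t p r : V →L[ℝ] V} {v : V} {M : ℕ → ℕ → ℕ → V}

theorem hasSum_apply {f : ℕ → V →L[ℝ] V} {F : V →L[ℝ] V} (h : HasSum f F) (v : V) :
    HasSum (fun n => f n v) (F v) :=
  h.mapL (ContinuousLinearMap.apply ℝ V v)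

/-- The operators `p` and `r` have the expansions `∑ aⁿ tⁿ⁺¹` and `∑ bⁿ tⁿ⁺¹`, and `M k l j`
is the value of `aᵏ bˡ tʲ` at `v`. -/
structure IsExpansion (a b t p r : V →L[ℝ] V) (v : V) (M : ℕ → ℕ → ℕ → V) : Prop where
  commute_a : Commute a t
  commute_b : Commute b t
  hasAbsSum_p : HasAbsSum (fun n => a ^ n * t ^ (n + 1)) p
  hasAbsSum_r : HasAbsSum (fun n => b ^ n * t ^ (n + 1)) r
  apply_eq : ∀ k l j, (a ^ k * b ^ l * t ^ j) v = M k l j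

namespace IsExpansion

theorem apply_sum (h : IsExpansion a b t p r v M) (N j : ℕ) (c : ℕ → ℝ) (e e' : ℕ → ℕ) :
    (∑ k ∈ Icc 1 N, c k • (a ^ e k * b ^ e' k * t ^ j)) v =
      ∑ k ∈ Icc 1 N, c k • M (e k) (e' k) j := by
  simp only [_root_.sum_apply, smul_apply, h.apply_eq]

theorem apply_powers (h : IsExpansion a b t p r v M) (n j : ℕ) (c : ℝ) :
    (c • (a ^ n * t ^ j)) v = c • M n 0 j := by
  rw [← h.apply_eq, pow_zero, mul_one]; rfl

theorem cast_sub_of_mem {n k : ℕ} (hk : k ∈ Icc 1 (n + 1)) :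
    ((n + 1 - k : ℕ) : ℝ) = n + 1 - k ∧ ((k - 1 : ℕ) : ℝ) = k - 1 := by
  rw [mem_Icc] at hk
  rw [Nat.cast_sub hk.2, Nat.cast_sub hk.1]
  push_cast
  exact ⟨rfl, rfl⟩

variable [CompleteSpace V]

theorem hasSum_pp (h : IsExpansion a b t p r v M) :
    HasSum (fun n : ℕ => ((n : ℝ) + 1) • M n 0 (n + 2)) ((p * p) v) := by
  simpa only [h.apply_powers] using hasSum_apply (h.hasAbsSum_p.sq_powers h.commute_a).2 v

theorem hasSum_ppp (h : IsExpansion a b t p r v M) :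
    HasSum (fun n : ℕ => (((n : ℝ) + 1) * (n + 2) / 2) • M n 0 (n + 3)) ((p * (p * p)) v) := by
  simpa only [h.apply_powers] using hasSum_apply (h.hasAbsSum_p.cube_powers h.commute_a).2 v

theorem hasSum_pr (h : IsExpansion a b t p r v M) :
    HasSum (fun n : ℕ => ∑ k ∈ Icc 1 (n + 1), M (n + 1 - k) (k - 1) (n + 2)) ((p * r) v) := by
  have := hasSum_apply (h.hasAbsSum_p.one_smul_powers.mul_powers h.commute_b
    h.hasAbsSum_r.one_smul_powers) v
  simp only [h.apply_sum] at this
  refine hasSum_of_forall_eq this fun n => sum_congr rfl fun k _ => ?_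
  rw [mul_one, one_smul]

theorem hasSum_ppr (h : IsExpansion a b t p r v M) :
    HasSum (fun n : ℕ => ∑ k ∈ Icc 1 (n + 1),
      ((n : ℝ) + 2 - k) • M (n + 1 - k) (k - 1) (n + 3)) ((p * (p * r)) v) := by
  have := hasSum_apply ((h.hasAbsSum_p.sq_powers h.commute_a).mul_powers h.commute_b
    h.hasAbsSum_r.one_smul_powers) v
  rw [mul_assoc] at this
  simp only [h.apply_sum] at this
  refine hasSum_of_forall_eq this fun n => sum_congr rfl fun k hk => ?_
  congr 1
  rw [(cast_sub_of_mem hk).1]; ring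

theorem hasSum_prr (h : IsExpansion a b t p r v M) :
    HasSum (fun n : ℕ => ∑ k ∈ Icc 1 (n + 1),
      (k : ℝ) • M (n + 1 - k) (k - 1) (n + 3)) ((p * (r * r)) v) := by
  have := hasSum_apply (h.hasAbsSum_p.one_smul_powers.mul_powers h.commute_b
    (h.hasAbsSum_r.sq_powers h.commute_b)) v
  simp only [h.apply_sum] at this
  refine hasSum_of_forall_eq this fun n => sum_congr rfl fun k hk => ?_
  congr 1
  -- The series of `r²` has weight `l + 1` at `bˡ`; here `l = k - 1`, so the weight is `k`.
  rw [(cast_sub_of_mem hk).2]; ring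

theorem hasSum_pprr (h : IsExpansion a b t p r v M) :
    HasSum (fun n : ℕ => ∑ k ∈ Icc 1 (n + 1),
      (((n : ℝ) + 2 - k) * k) • M (n + 1 - k) (k - 1) (n + 4)) ((p * (p * (r * r))) v) := by
  have := hasSum_apply ((h.hasAbsSum_p.sq_powers h.commute_a).mul_powers h.commute_b
    (h.hasAbsSum_r.sq_powers h.commute_b)) v
  rw [mul_assoc] at this
  simp only [h.apply_sum] at this
  refine hasSum_of_forall_eq this fun n => sum_congr rfl fun k hk => ?_
  congr 1
  rw [(cast_sub_of_mem hk).1, (cast_sub_of_mem hk).2]; ring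

theorem hasSum_pppr (h : IsExpansion a b t p r v M) :
    HasSum (fun n : ℕ => ∑ k ∈ Icc 1 (n + 1),
      (((n : ℝ) + 2 - k) * (n + 3 - k) / 2) • M (n + 1 - k) (k - 1) (n + 4))
      ((p * (p * (p * r))) v) := by
  have := hasSum_apply ((h.hasAbsSum_p.cube_powers h.commute_a).mul_powers h.commute_b
    h.hasAbsSum_r.one_smul_powers) v
  rw [mul_assoc, mul_assoc] at this
  simp only [h.apply_sum] at this
  refine hasSum_of_forall_eq this fun n => sum_congr rfl fun k hk => ?_
  congr 1
  rw [(cast_sub_of_mem hk).1]; ring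

/-! The expansions of the kernels, written as series over `m`. -/

theorem hasSum_dirac (h : IsExpansion a b t p r v M) :
    HasSum (fun n : ℕ => (-4 : ℝ) • ∑ k ∈ Icc 1 (n + 1),
      M (n + 1 - k) (k - 1) (1 + (n + 1))) ((-(4 : ℝ) • (p * r)) v) := by
  refine hasSum_of_forall_eq (h.hasSum_pr.const_smul (-4 : ℝ))
    fun n => ?_
  -- With `m = n + 1` the exponent `n + 2` is written `1 + m`, as in `negPow`.
  rw [add_comm 1 (n + 1)]

theorem hasSum_laplacian (h : IsExpansion a b t p r v M) :
    HasSum (fun n : ℕ => (-8 : ℝ) • ∑ k ∈ Icc 1 (n + 2 - 1), (((n + 2 : ℕ) : ℝ) - k) •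
      M (n + 2 - k - 1) (k - 1) (1 + (n + 2))) ((-(8 : ℝ) • (p * (p * r))) v) := by
  refine hasSum_of_forall_eq (h.hasSum_ppr.const_smul (-8 : ℝ))
    fun n => ?_
  congr 1
  refine sum_congr rfl fun k _ => ?_
  rw [add_comm 1 (n + 2), show n + 2 - k - 1 = n + 1 - k by omega]
  push_cast
  rfl

theorem hasSum_dirac_dirac (h : IsExpansion a b t p r v M) :
    HasSum (fun n : ℕ => (-8 : ℝ) • ∑ k ∈ Icc 1 (n + 2 - 1), (k : ℝ) •
      M (n + 2 - k - 1) (k - 1) (1 + (n + 2))) ((-(8 : ℝ) • (p * (r * r))) v) := by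
  refine hasSum_of_forall_eq (h.hasSum_prr.const_smul (-8 : ℝ))
    fun n => ?_
  congr 1
  refine sum_congr rfl fun k _ => ?_
  rw [add_comm 1 (n + 2), show n + 2 - k - 1 = n + 1 - k by omega]

theorem hasSum_laplacian_dirac (h : IsExpansion a b t p r v M) :
    HasSum (fun n : ℕ => (16 : ℝ) • ∑ k ∈ Icc 1 (n + 3 - 2), ((((n + 3 : ℕ) : ℝ) - k - 1) * k) •
      M (n + 3 - k - 2) (k - 1) (1 + (n + 3))) (((16 : ℝ) • (p * (p * (r * r)))) v) := by
  refine hasSum_of_forall_eq (h.hasSum_pprr.const_smul (16 : ℝ))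
    fun n => ?_
  congr 1
  refine sum_congr rfl fun k _ => ?_
  rw [add_comm 1 (n + 3), show n + 3 - k - 2 = n + 1 - k by omega]
  congr 1
  push_cast
  ring

theorem hasSum_diracBar (h : IsExpansion a b t p r v M) :
    HasSum (fun n : ℕ => (2 : ℝ) • (((n + 1 : ℕ) : ℝ) • M (n + 1 - 1) 0 (1 + (n + 1)) +
      (2 : ℝ) • ∑ k ∈ Icc 1 (n + 1), M (n + 1 - k) (k - 1) (1 + (n + 1))))
      (((2 : ℝ) • (p * p) + (4 : ℝ) • (p * r)) v) := by
  refine hasSum_of_forall_eq ((h.hasSum_pp.const_smul (2 : ℝ)).add (h.hasSum_pr.const_smul (4 : ℝ)))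
    fun n => ?_
  rw [add_comm 1 (n + 1), Nat.add_sub_cancel]
  push_cast
  module

theorem hasSum_diracBar_diracBar (h : IsExpansion a b t p r v M) :
    HasSum (fun n : ℕ => (4 : ℝ) •
      ((((n + 2 : ℕ) : ℝ) * (((n + 2 : ℕ) : ℝ) - 1)) • M (n + 2 - 2) 0 (1 + (n + 2)) +
      (2 : ℝ) • ∑ k ∈ Icc 1 (n + 2 - 1), (2 * ((n + 2 : ℕ) : ℝ) - k) •
        M (n + 2 - k - 1) (k - 1) (1 + (n + 2))))
      (((8 : ℝ) • (p * (p * p)) + (16 : ℝ) • (p * (p * r)) + (8 : ℝ) • (p * (r * r))) v) := by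
  refine hasSum_of_forall_eq (((h.hasSum_ppp.const_smul (8 : ℝ)).add (h.hasSum_ppr.const_smul (16 : ℝ))).add
    (h.hasSum_prr.const_smul (8 : ℝ)))
    fun n => ?_
  rw [add_comm 1 (n + 2), Nat.add_sub_cancel, smul_add]
  -- With `m = n + 2`, the cube gives `8·m(m-1)/2`, and the two mixed series combine as `16(m-k) +
  -- 8k = 8(2m-k)`.
  refine (congrArg₂ (· + ·) ?_ ?_).trans (add_assoc _ _ _).symm
  · push_cast
    module
  · simp only [smul_sum, ← sum_add_distrib]
    refine sum_congr rfl fun k _ => ?_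
    rw [show n + 2 - k - 1 = n + 1 - k by omega]
    push_cast
    module

theorem hasSum_laplacian_diracBar (h : IsExpansion a b t p r v M) :
    HasSum (fun n : ℕ => (-16 : ℝ) • ∑ k ∈ Icc 1 (n + 3 - 2),
      ((((n + 3 : ℕ) : ℝ) - k - 1) * (((n + 3 : ℕ) : ℝ) + k)) •
        M (n + 3 - k - 2) (k - 1) (1 + (n + 3)))
      ((-(32 : ℝ) • (p * (p * (p * r))) - (32 : ℝ) • (p * (p * (r * r)))) v) := by
  refine hasSum_of_forall_eq ((h.hasSum_pppr.const_smul (-32 : ℝ)).sub (h.hasSum_pprr.const_smul (32 : ℝ)))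
    fun n => ?_
  -- With `m = n + 3`, each coefficient is `-16(m-k-1)((m-k) + 2k) = -16(m-k-1)(m+k)`.
  simp only [smul_sum, ← sum_sub_distrib]
  refine sum_congr rfl fun k _ => ?_
  rw [add_comm 1 (n + 3), show n + 3 - k - 2 = n + 1 - k by omega]
  push_cast
  module

end IsExpansion
end Expansions
end FineStructure

end

noncomputable section

namespace FineStructure

open scoped Laplacian
open Filter Topology

/-! ### Complex planes in `R5`: bounds, invertibility, smoothness -/

section Paravectors

instance instCompleteSpaceR5 : CompleteSpace R5 := FiniteDimensional.complete ℝ R5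

theorem isCliffordFamily_e : IsCliffordFamily e (0 : R5) where
  mul_self := e_mul_self
  anticomm _ _ h := e_mul_add_swap h
  comm _ := Commute.zero_right _

theorem par_eq (x : E6) : par x = parOf e x := rfl

theorem conj_eq (x : E6) : conj x = parOf (-e) x := (parOf_neg e x).symm

/-- A paravector lies in a copy of the complex plane. -/
theorem exists_algHom_complex (y : E6) : ∃ (φ : ℂ →ₐ[ℝ] R5) (z : ℂ), φ z = par y ∧
    φ (starRingEnd ℂ z) = conj y ∧ ‖z‖ = ‖y‖ ∧ z.re = y 0 := by
  obtain ⟨ρ, hρ⟩ : ∃ ρ : ℝ, ρ = √(∑ i : Fin 5, y i.succ ^ 2) := ⟨_, rfl⟩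
  have hnn : 0 ≤ ∑ i : Fin 5, y i.succ ^ 2 := Finset.sum_nonneg fun i _ => sq_nonneg _
  have hρ2 : ρ ^ 2 = ∑ i : Fin 5, y i.succ ^ 2 := by rw [hρ, Real.sq_sqrt hnn]
  obtain ⟨I, hI, hyI⟩ : ∃ I : R5, I * I = -1 ∧ vecOf e y = ρ • I := by
    -- A real paravector lies in every such plane, so any unit serves as `I`; otherwise the vector
    -- part is normalised.
    by_cases h0 : ρ = 0
    · refine ⟨e 0, e_mul_self 0, ?_⟩
      rw [h0, zero_pow two_ne_zero, eq_comm, Finset.sum_eq_zero_iff_of_nonneg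
        fun i _ => sq_nonneg _] at hρ2
      rw [h0, zero_smul]
      refine Finset.sum_eq_zero fun i hi => ?_
      rw [pow_eq_zero_iff two_ne_zero |>.1 (hρ2 i hi), zero_smul]
    · refine ⟨ρ⁻¹ • vecOf e y, ?_, by rw [smul_inv_smul₀ h0]⟩
      rw [smul_mul_smul_comm, vecOf_mul_self isCliffordFamily_e, ← hρ2,
        Algebra.algebraMap_eq_smul_one, smul_smul]
      have : ρ⁻¹ * ρ⁻¹ * -ρ ^ 2 = -1 := by field_simp
      rw [this, neg_one_smul]
  refine ⟨Complex.liftAux I hI, ⟨y 0, ρ⟩, ?_, ?_, ?_, rfl⟩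
  · rw [Complex.liftAux_apply, par_eq, parOf_eq_add, hyI]
  · rw [Complex.liftAux_apply, conj_eq, parOf_neg, hyI]
    simp [sub_eq_add_neg]
  · rw [← sq_eq_sq₀ (norm_nonneg _) (norm_nonneg _), norm_sq_eq, ← hρ2, Complex.sq_norm,
      Complex.normSq_mk]
    ring

theorem exists_bound_algHom (φ : ℂ →ₐ[ℝ] R5) : ∃ C, ∀ z, ‖φ z‖ ≤ C * ‖z‖ :=
  ⟨_, (LinearMap.toContinuousLinearMap φ.toLinearMap).le_opNorm⟩

/-- The norm of `R5` is submultiplicative but need not equal `|y|` on paravectors; in the complex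
plane the power has modulus `|y|ⁿ`, and `φ` costs only a constant. -/
theorem exists_bound_par_pow (y : E6) :
    ∃ C, ∀ n : ℕ, ‖par y ^ n‖ ≤ C * ‖y‖ ^ n ∧ ‖conj y ^ n‖ ≤ C * ‖y‖ ^ n := by
  obtain ⟨φ, z, hz, hz', hn, -⟩ := exists_algHom_complex y
  obtain ⟨C, hC⟩ := exists_bound_algHom φ
  refine ⟨C, fun n => ⟨?_, ?_⟩⟩
  · have := hC (z ^ n)
    rwa [map_pow, hz, norm_pow z, hn] at this
  · have := hC (starRingEnd ℂ z ^ n)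
    rwa [map_pow, hz', norm_pow (starRingEnd ℂ z), RCLike.norm_conj, hn] at this

theorem isUnit_par {s : E6} (hs : 0 < ‖s‖) : IsUnit (par s) := by
  obtain ⟨φ, z, hz, -, hn, -⟩ := exists_algHom_complex s
  rw [← hz]
  exact (isUnit_iff_ne_zero.2 (norm_pos_iff.1 (hn ▸ hs))).map φ

theorem exists_bound_inverse_par_pow {s : E6} (hs : 0 < ‖s‖) :
    ∃ C, ∀ n : ℕ, ‖Ring.inverse (par s) ^ n‖ ≤ C * ‖s‖⁻¹ ^ n := by
  obtain ⟨φ, z, hz, -, hn, -⟩ := exists_algHom_complex s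
  obtain ⟨C, hC⟩ := exists_bound_algHom φ
  have hz0 : z ≠ 0 := norm_pos_iff.1 (hn ▸ hs)
  have hinv : Ring.inverse (par s) = φ z⁻¹ := by
    have h1 : par s * φ z⁻¹ = 1 := by rw [← hz, ← map_mul, mul_inv_cancel₀ hz0, map_one]
    rw [← mul_one (Ring.inverse _), Ring.inverse_mul_eq_iff_eq_mul _ _ _ (isUnit_par hs), h1]
  refine ⟨C, fun n => ?_⟩
  have := hC (z⁻¹ ^ n)
  rwa [map_pow, ← hinv, norm_pow z⁻¹, norm_inv, hn] at this

theorem isUnit_Qc {s x : E6} (hxs : ‖x‖ < ‖s‖) : IsUnit (Qc s x) := by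
  obtain ⟨φ, z, hz, -, hn, -⟩ := exists_algHom_complex s
  -- `Qc s x` sees `x` only through `x₀` and `|x|`, so the complex number `w` can be transplanted
  -- into the plane of `s`.
  obtain ⟨-, w, -, -, hw, hw'⟩ := exists_algHom_complex x
  have key : Qc s x = φ ((z - w) * (z - starRingEnd ℂ w)) := by
    have e : (z - w) * (z - starRingEnd ℂ w) =
        z ^ 2 - (2 * x 0) • z + algebraMap ℝ ℂ (‖x‖ ^ 2) := by
      have h1 : w + starRingEnd ℂ w = ((2 * x 0 : ℝ) : ℂ) := by rw [Complex.add_conj, hw']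
      have h2 : w * starRingEnd ℂ w = ((‖x‖ ^ 2 : ℝ) : ℂ) := by
        rw [Complex.mul_conj, ← hw, Complex.sq_norm]
      rw [Complex.real_smul, ← h1, Complex.coe_algebraMap, ← h2]
      ring
    rw [e, map_add, map_sub, map_pow, map_smul, AlgHom.commutes, hz, Qc]
  have ne_of_norm : ∀ w' : ℂ, ‖w'‖ = ‖x‖ → z - w' ≠ 0 := fun w' h' h => by
    rw [sub_eq_zero] at h
    rw [← hn, h, h'] at hxs
    exact lt_irrefl _ hxs
  rw [key]
  exact (isUnit_iff_ne_zero.2 (mul_ne_zero (ne_of_norm w hw)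
    (ne_of_norm _ ((RCLike.norm_conj w).trans hw)))).map φ

theorem contDiff_conj : ContDiff ℝ (⊤ : ℕ∞) conj :=
  (funext conj_eq : conj = parOf (-e)) ▸ contDiff_parOf (-e)

theorem contDiffAt_inverse_Qc {s x : E6} (hxs : ‖x‖ < ‖s‖) :
    ContDiffAt ℝ (⊤ : ℕ∞) (fun y => Ring.inverse (Qc s y)) x := by
  obtain ⟨u, hu⟩ := isUnit_Qc hxs
  have h2 := contDiffAt_ringInverse (n := ((⊤ : ℕ∞) : WithTop ℕ∞)) ℝ u
  rw [hu] at h2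
  have h3 : ContDiff ℝ (⊤ : ℕ∞) (Qc s) := by
    have h0 : ContDiff ℝ (⊤ : ℕ∞) fun y : E6 => y 0 := by fun_prop
    have h4 : ContDiff ℝ (⊤ : ℕ∞) fun y : E6 => (2 * y 0) • par s := by fun_prop
    have h5 : ContDiff ℝ (⊤ : ℕ∞) fun y : E6 => algebraMap ℝ R5 (‖y‖ ^ 2) :=
      (algebraMapCLM ℝ R5).contDiff.comp (contDiff_norm_sq ℝ)
    exact (contDiff_const.sub h4).add h5
  exact h2.comp x h3.contDiffAt

theorem contDiffAt_SL {s x : E6} (hxs : ‖x‖ < ‖s‖) : ContDiffAt ℝ (⊤ : ℕ∞) (SL s) x :=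
  (contDiff_const.sub contDiff_conj).contDiffAt.mul (contDiffAt_inverse_Qc hxs)

theorem contDiffAt_SR {s x : E6} (hxs : ‖x‖ < ‖s‖) : ContDiffAt ℝ (⊤ : ℕ∞) (SR s) x :=
  (contDiffAt_inverse_Qc hxs).mul (contDiff_const.sub contDiff_conj).contDiffAt

end Paravectors

/-! ### Left and right multiplications as operators on `R5` -/

section Multiplication

/-- Left multiplication by `a`. -/
def mulL (a : R5) : R5 →L[ℝ] R5 := ContinuousLinearMap.mul ℝ R5 a

/-- Right multiplication by `a`. -/
def mulR (a : R5) : R5 →L[ℝ] R5 := (ContinuousLinearMap.mul ℝ R5).flip a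

theorem mulL_apply (a b : R5) : mulL a b = a * b := rfl

theorem mulR_apply (a b : R5) : mulR a b = b * a := rfl

theorem mulL_mul (a b : R5) : mulL (a * b) = mulL a * mulL b :=
  ContinuousLinearMap.ext fun c => mul_assoc a b c

theorem mulR_mul (a b : R5) : mulR (a * b) = mulR b * mulR a :=
  ContinuousLinearMap.ext fun c => (mul_assoc c a b).symm

theorem mulL_one : mulL 1 = 1 := ContinuousLinearMap.ext one_mul

theorem mulR_one : mulR 1 = 1 := ContinuousLinearMap.ext mul_one

theorem mulL_pow (a : R5) (n : ℕ) : mulL (a ^ n) = mulL a ^ n := by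
  induction n with
  | zero => rw [pow_zero, pow_zero, mulL_one]
  | succ n ih => rw [pow_succ, mulL_mul, ih, pow_succ]

theorem mulR_pow (a : R5) (n : ℕ) : mulR (a ^ n) = mulR a ^ n := by
  induction n with
  | zero => rw [pow_zero, pow_zero, mulR_one]
  | succ n ih => rw [pow_succ, mulR_mul, ih, pow_succ']

theorem commute_mulL_mulR (a b : R5) : Commute (mulL a) (mulR b) :=
  ContinuousLinearMap.ext fun c => (mul_assoc a c b).symm

theorem norm_mulL_le (a : R5) : ‖mulL a‖ ≤ ‖a‖ := ContinuousLinearMap.opNorm_mul_apply_le ℝ R5 a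

theorem norm_mulR_le (a : R5) : ‖mulR a‖ ≤ ‖a‖ :=
  ContinuousLinearMap.opNorm_le_bound _ (norm_nonneg a) fun b =>
    (norm_mul_le b a).trans_eq (mul_comm _ _)

theorem isUnit_mulL {a : R5} (h : IsUnit a) :
    IsUnit (mulL a) ∧ Ring.inverse (mulL a) = mulL (Ring.inverse a) := by
  let u : (R5 →L[ℝ] R5)ˣ := ⟨mulL a, mulL (Ring.inverse a),
    by rw [← mulL_mul, Ring.mul_inverse_cancel _ h, mulL_one],
    by rw [← mulL_mul, Ring.inverse_mul_cancel _ h, mulL_one]⟩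
  exact ⟨⟨u, rfl⟩, Ring.inverse_unit u⟩

theorem isUnit_mulR {a : R5} (h : IsUnit a) :
    IsUnit (mulR a) ∧ Ring.inverse (mulR a) = mulR (Ring.inverse a) := by
  let u : (R5 →L[ℝ] R5)ˣ := ⟨mulR a, mulR (Ring.inverse a),
    by rw [← mulR_mul, Ring.inverse_mul_cancel _ h, mulR_one],
    by rw [← mulR_mul, Ring.mul_inverse_cancel _ h, mulR_one]⟩
  exact ⟨⟨u, rfl⟩, Ring.inverse_unit u⟩

/-- The left multiplications by the imaginary units. -/
def unitsL (i : Fin 5) : R5 →L[ℝ] R5 := mulL (e i)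

/-- The right multiplications by the imaginary units. -/
def unitsR (i : Fin 5) : R5 →L[ℝ] R5 := mulR (e i)

theorem isCliffordFamily_unitsL (s : R5) : IsCliffordFamily unitsL (mulR s) where
  mul_self i := by
    rw [unitsL, ← mulL_mul, e_mul_self]
    exact ContinuousLinearMap.ext fun c => neg_one_mul c
  anticomm i j h := by
    rw [unitsL, unitsL, ← mulL_mul, ← mulL_mul]
    exact ContinuousLinearMap.ext fun c => by
      rw [add_apply, mulL_apply, mulL_apply, ← add_mul, e_mul_add_swap h, zero_mul]; rfl
  comm i := commute_mulL_mulR _ _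

/-- Right multiplication reverses products, but the defining relations of the units are symmetric
under reversal. -/
theorem isCliffordFamily_unitsR (s : R5) : IsCliffordFamily unitsR (mulL s) where
  mul_self i := by
    rw [unitsR, ← mulR_mul, e_mul_self]
    exact ContinuousLinearMap.ext fun c => mul_neg_one c
  anticomm i j h := by
    rw [unitsR, unitsR, ← mulR_mul, ← mulR_mul]
    exact ContinuousLinearMap.ext fun c => by
      rw [add_apply, mulR_apply, mulR_apply, ← mul_add, e_mul_add_swap h.symm, mul_zero]; rfl
  comm i := (commute_mulL_mulR _ _).symm

theorem vecOf_unitsL (x : E6) : vecOf unitsL x = mulL (vecOf e x) := by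
  simp only [vecOf, unitsL, mulL, map_sum, map_smul]

theorem vecOf_unitsR (x : E6) : vecOf unitsR x = mulR (vecOf e x) := by
  simp only [vecOf, unitsR, mulR, map_sum, map_smul]

theorem mulL_algebraMap (c : ℝ) : mulL (algebraMap ℝ R5 c) = algebraMap ℝ (R5 →L[ℝ] R5) c :=
  ContinuousLinearMap.ext fun b => (Algebra.smul_def c b).symm

theorem mulR_algebraMap (c : ℝ) : mulR (algebraMap ℝ R5 c) = algebraMap ℝ (R5 →L[ℝ] R5) c :=
  ContinuousLinearMap.ext fun b => ((Algebra.commutes c b).symm.trans (Algebra.smul_def c b).symm)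

theorem parOf_unitsL (x : E6) : parOf unitsL x = mulL (par x) := by
  rw [parOf_eq_add, vecOf_unitsL, ← mulL_algebraMap, par_eq, parOf_eq_add]
  exact (map_add (ContinuousLinearMap.mul ℝ R5) _ _).symm

theorem parOf_neg_unitsL (x : E6) : parOf (-unitsL) x = mulL (conj x) := by
  rw [parOf_neg, vecOf_unitsL, ← mulL_algebraMap, conj_eq, parOf_neg]
  exact (map_sub (ContinuousLinearMap.mul ℝ R5) _ _).symm

theorem parOf_unitsR (x : E6) : parOf unitsR x = mulR (par x) := by
  rw [parOf_eq_add, vecOf_unitsR, ← mulR_algebraMap, par_eq, parOf_eq_add]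
  exact (map_add (ContinuousLinearMap.mul ℝ R5).flip _ _).symm

theorem parOf_neg_unitsR (x : E6) : parOf (-unitsR) x = mulR (conj x) := by
  rw [parOf_neg, vecOf_unitsR, ← mulR_algebraMap, conj_eq, parOf_neg]
  exact (map_sub (ContinuousLinearMap.mul ℝ R5).flip _ _).symm

theorem diracL_eq (f : E6 → R5) : diracL f = diracOf unitsL f := rfl

theorem diracR_eq (f : E6 → R5) : diracR f = diracOf unitsR f := rfl

theorem diracBarL_eq (f : E6 → R5) : diracBarL f = diracOf (-unitsL) f := by
  funext x
  simp only [diracBarL, diracOf, Pi.neg_apply, neg_apply, Finset.sum_neg_distrib, sub_eq_add_neg]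
  rfl

theorem diracBarR_eq (f : E6 → R5) : diracBarR f = diracOf (-unitsR) f := by
  funext x
  simp only [diracBarR, diracOf, Pi.neg_apply, neg_apply, Finset.sum_neg_distrib, sub_eq_add_neg]
  rfl

theorem summable_mul_geometric {f g : ℕ → R5} {C C' α β : ℝ} (hα : 0 ≤ α) (hαβ : α < β)
    (hf : ∀ n, ‖f n‖ ≤ C * α ^ n) (hg : ∀ n, ‖g n‖ ≤ C' * β⁻¹ ^ n) :
    Summable fun n => ‖f n‖ * ‖g (n + 1)‖ := by
  have hβ : 0 < β := hα.trans_lt hαβ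
  have hs : Summable fun n : ℕ => (C * C' * β⁻¹) * (α / β) ^ n :=
    (summable_geometric_of_lt_one (by positivity) ((div_lt_one hβ).2 hαβ)).mul_left _
  refine hs.of_nonneg_of_le (fun n => by positivity) fun n => ?_
  refine (mul_le_mul (hf n) (hg (n + 1)) (norm_nonneg _) ((norm_nonneg _).trans (hf n))).trans_eq ?_
  rw [div_eq_mul_inv, mul_pow, pow_succ]
  ring

end Multiplication
end FineStructure

end

noncomputable section

namespace FineStructure

open scoped Laplacian
open Filter Topology

/-! ### The Cauchy kernels as resolvents, and their expansions -/

section CauchyKernels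

variable {s x : E6}

theorem commute_conj_par (x : E6) : Commute (conj x) (par x) := by
  rw [conj_eq, par_eq]
  exact (commute_parOf_neg e x).symm

theorem mulR_Qc (s x : E6) :
    mulR (Qc s x) = mulR (par s) ^ 2 - (2 * x 0) • mulR (par s) +
      algebraMap ℝ (R5 →L[ℝ] R5) (‖x‖ ^ 2) := by
  rw [← mulR_pow, ← mulR_algebraMap]
  simp only [Qc, mulR, map_add, map_sub, map_smul]

theorem mulL_Qc (s x : E6) :
    mulL (Qc s x) = mulL (par s) ^ 2 - (2 * x 0) • mulL (par s) +
      algebraMap ℝ (R5 →L[ℝ] R5) (‖x‖ ^ 2) := by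
  rw [← mulL_pow, ← mulL_algebraMap]
  simp only [Qc, mulL, map_add, map_sub, map_smul]

theorem summable_mulL_mulR {y : E6} {g : E6 → R5} (hg : g = par ∨ g = conj) (h : ‖y‖ < ‖s‖) :
    Summable fun n : ℕ => ‖mulL (g y) ^ n * Ring.inverse (mulR (par s)) ^ (n + 1)‖ := by
  have hs : 0 < ‖s‖ := (norm_nonneg y).trans_lt h
  obtain ⟨C, hC⟩ := exists_bound_par_pow y
  obtain ⟨C', hC'⟩ := exists_bound_inverse_par_pow hs
  have hb : ∀ n, ‖g y ^ n‖ ≤ C * ‖y‖ ^ n := by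
    rcases hg with rfl | rfl
    exacts [fun n => (hC n).1, fun n => (hC n).2]
  refine (summable_mul_geometric (norm_nonneg y) h hb hC').of_nonneg_of_le
    (fun n => norm_nonneg _) fun n => ?_
  rw [(isUnit_mulR (isUnit_par hs)).2, ← mulL_pow, ← mulR_pow]
  exact (norm_mul_le _ _).trans (mul_le_mul (norm_mulL_le _) (norm_mulR_le _) (norm_nonneg _)
    (norm_nonneg _))

theorem summable_mulR_mulL {y : E6} {g : E6 → R5} (hg : g = par ∨ g = conj) (h : ‖y‖ < ‖s‖) :
    Summable fun n : ℕ => ‖mulR (g y) ^ n * Ring.inverse (mulL (par s)) ^ (n + 1)‖ := by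
  have hs : 0 < ‖s‖ := (norm_nonneg y).trans_lt h
  obtain ⟨C, hC⟩ := exists_bound_par_pow y
  obtain ⟨C', hC'⟩ := exists_bound_inverse_par_pow hs
  have hb : ∀ n, ‖g y ^ n‖ ≤ C * ‖y‖ ^ n := by
    rcases hg with rfl | rfl
    exacts [fun n => (hC n).1, fun n => (hC n).2]
  refine (summable_mul_geometric (norm_nonneg y) h hb hC').of_nonneg_of_le
    (fun n => norm_nonneg _) fun n => ?_
  rw [(isUnit_mulL (isUnit_par hs)).2, ← mulR_pow, ← mulL_pow]
  exact (norm_mul_le _ _).trans (mul_le_mul (norm_mulR_le _) (norm_mulL_le _) (norm_nonneg _)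
    (norm_nonneg _))

theorem resolvent_mulL {y : E6} {g : E6 → R5} (hg : g = par ∨ g = conj) (h : ‖y‖ < ‖s‖) :
    IsUnit (mulR (par s) - mulL (g y)) ∧
      HasAbsSum (fun n => mulL (g y) ^ n * Ring.inverse (mulR (par s)) ^ (n + 1))
        (Ring.inverse (mulR (par s) - mulL (g y))) :=
  hasAbsSum_resolvent (isUnit_mulR (isUnit_par ((norm_nonneg y).trans_lt h))).1
    (commute_mulL_mulR _ _) (summable_mulL_mulR hg h)

theorem resolvent_mulR {y : E6} {g : E6 → R5} (hg : g = par ∨ g = conj) (h : ‖y‖ < ‖s‖) :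
    IsUnit (mulL (par s) - mulR (g y)) ∧
      HasAbsSum (fun n => mulR (g y) ^ n * Ring.inverse (mulL (par s)) ^ (n + 1))
        (Ring.inverse (mulL (par s) - mulR (g y))) :=
  hasAbsSum_resolvent (isUnit_mulL (isUnit_par ((norm_nonneg y).trans_lt h))).1
    (commute_mulL_mulR _ _).symm (summable_mulR_mulL hg h)

theorem isResolventSet_left (s : E6) :
    IsResolventSet unitsL (mulR (par s)) (Metric.ball 0 ‖s‖) where
  family := isCliffordFamily_unitsL _
  isOpen := Metric.isOpen_ball
  isUnit y hy := by
    rw [parOf_unitsL]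
    exact (resolvent_mulL (Or.inl rfl) (mem_ball_zero_iff.1 hy)).1
  isUnit_neg y hy := by
    rw [parOf_neg_unitsL]
    exact (resolvent_mulL (Or.inr rfl) (mem_ball_zero_iff.1 hy)).1

theorem isResolventSet_right (s : E6) :
    IsResolventSet unitsR (mulL (par s)) (Metric.ball 0 ‖s‖) where
  family := isCliffordFamily_unitsR _
  isOpen := Metric.isOpen_ball
  isUnit y hy := by
    rw [parOf_unitsR]
    exact (resolvent_mulR (Or.inl rfl) (mem_ball_zero_iff.1 hy)).1
  isUnit_neg y hy := by
    rw [parOf_neg_unitsR]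
    exact (resolvent_mulR (Or.inr rfl) (mem_ball_zero_iff.1 hy)).1

/-- The factorisation turns `p` into right multiplication by `Q⁻¹` composed with `σ - x̄`; at `1`
this is `(s - x̄) Q⁻¹`. -/
theorem SL_eq_res (s : E6) :
    ∀ y ∈ Metric.ball (0 : E6) ‖s‖, SL s y = res unitsL (mulR (par s)) y 1 := by
  intro y hy
  have hQ := isUnit_Qc (mem_ball_zero_iff.1 hy)
  have hu := (isResolventSet_left s).isUnit y hy
  have h := isCliffordFamily_unitsL (par s)
  have h1 : res unitsL (mulR (par s)) y =
      mulR (Ring.inverse (Qc s y)) * (mulR (par s) - parOf (-unitsL) y) := by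
    rw [← one_mul (res _ _ _), res, eq_comm, Ring.eq_mul_inverse_iff_mul_eq _ _ _ hu, mul_assoc,
      ← (commute_sub_parOf h y).eq, sub_parOf_mul_sub_parOf_neg h, ← mulR_Qc, ← mulR_mul,
      Ring.mul_inverse_cancel _ hQ, mulR_one]
  rw [h1, parOf_neg_unitsL]
  change _ = ((1 : R5) * par s - conj y * 1) * Ring.inverse (Qc s y)
  rw [one_mul, mul_one, SL]

theorem SR_eq_res (s : E6) :
    ∀ y ∈ Metric.ball (0 : E6) ‖s‖, SR s y = res unitsR (mulL (par s)) y 1 := by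
  intro y hy
  have hQ := isUnit_Qc (mem_ball_zero_iff.1 hy)
  have hu := (isResolventSet_right s).isUnit y hy
  have h := isCliffordFamily_unitsR (par s)
  have h1 : res unitsR (mulL (par s)) y =
      mulL (Ring.inverse (Qc s y)) * (mulL (par s) - parOf (-unitsR) y) := by
    rw [← one_mul (res _ _ _), res, eq_comm, Ring.eq_mul_inverse_iff_mul_eq _ _ _ hu, mul_assoc,
      ← (commute_sub_parOf h y).eq, sub_parOf_mul_sub_parOf_neg h, ← mulL_Qc, ← mulL_mul,
      Ring.inverse_mul_cancel _ hQ, mulL_one]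
  rw [h1, parOf_neg_unitsR]
  change _ = Ring.inverse (Qc s y) * (par s * (1 : R5) - 1 * conj y)
  rw [one_mul, mul_one, SR]

theorem isExpansion_left (hxs : ‖x‖ < ‖s‖) :
    IsExpansion (mulL (par x)) (mulL (conj x)) (mulR (Ring.inverse (par s)))
      (res unitsL (mulR (par s)) x) (res (-unitsL) (mulR (par s)) x) 1
      (fun k l j => par x ^ k * conj x ^ l * Ring.inverse (par s) ^ j) := by
  have hs := (isUnit_mulR (isUnit_par ((norm_nonneg x).trans_lt hxs))).2
  refine ⟨commute_mulL_mulR _ _, commute_mulL_mulR _ _, ?_, ?_, fun k l j => ?_⟩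
  · rw [← hs, res, parOf_unitsL]
    exact (resolvent_mulL (Or.inl rfl) hxs).2
  · rw [← hs, res, parOf_neg_unitsL]
    exact (resolvent_mulL (Or.inr rfl) hxs).2
  · rw [← mulL_pow, ← mulL_pow, ← mulR_pow, ← mulL_mul]
    change par x ^ k * conj x ^ l * (1 * Ring.inverse (par s) ^ j) = _
    rw [one_mul]

theorem isExpansion_right (hxs : ‖x‖ < ‖s‖) :
    IsExpansion (mulR (par x)) (mulR (conj x)) (mulL (Ring.inverse (par s)))
      (res unitsR (mulL (par s)) x) (res (-unitsR) (mulL (par s)) x) 1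
      (fun k l j => Ring.inverse (par s) ^ j * par x ^ k * conj x ^ l) := by
  have hs := (isUnit_mulL (isUnit_par ((norm_nonneg x).trans_lt hxs))).2
  refine ⟨(commute_mulL_mulR _ _).symm, (commute_mulL_mulR _ _).symm, ?_, ?_, fun k l j => ?_⟩
  · rw [← hs, res, parOf_unitsR]
    exact (resolvent_mulR (Or.inl rfl) hxs).2
  · rw [← hs, res, parOf_neg_unitsR]
    exact (resolvent_mulR (Or.inr rfl) hxs).2
  · rw [← mulR_pow, ← mulR_pow, ← mulL_pow, ← mulR_mul]
    change Ring.inverse (par s) ^ j * 1 * (conj x ^ l * par x ^ k) = _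
    -- Right multiplications compose in reverse order; `x` and `x̄` commute, which restores the
    -- stated one.
    rw [mul_one, ((commute_conj_par x).pow_pow l k).eq, mul_assoc]

end CauchyKernels
end FineStructure
end

/-! ### Assembly of the kernel series -/

open FineStructure Finset in
theorem mainTheorem9 (s x : E6) (hxs : ‖x‖ < ‖s‖) :
    -- the objects in the expansions are well defined
    (IsUnit (par s) ∧ IsUnit (Qc s x) ∧
      ContDiffAt ℝ (⊤ : ℕ∞) (SL s) x ∧ ContDiffAt ℝ (⊤ : ℕ∞) (SR s) x) ∧
    -- the left and right `D`-kernels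
    HasSumFrom 1 (fun m => (-4 : ℝ) •
        ∑ k ∈ Icc 1 m, par x ^ (m - k) * conj x ^ (k - 1) * negPow s m)
      (kernelDL s x) ∧
    HasSumFrom 1 (fun m => (-4 : ℝ) •
        ∑ k ∈ Icc 1 m, negPow s m * par x ^ (m - k) * conj x ^ (k - 1))
      (kernelDR s x) ∧
    -- the left and right `Δ`-kernels
    HasSumFrom 2 (fun m => (-8 : ℝ) •
        ∑ k ∈ Icc 1 (m - 1), ((m : ℝ) - k) •
          (par x ^ (m - k - 1) * conj x ^ (k - 1) * negPow s m))
      (kernelLapL s x) ∧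
    HasSumFrom 2 (fun m => (-8 : ℝ) •
        ∑ k ∈ Icc 1 (m - 1), ((m : ℝ) - k) •
          (negPow s m * par x ^ (m - k - 1) * conj x ^ (k - 1)))
      (kernelLapR s x) ∧
    -- the left and right `ΔD`-kernels
    HasSumFrom 3 (fun m => (16 : ℝ) •
        ∑ k ∈ Icc 1 (m - 2), (((m : ℝ) - k - 1) * k) •
          (par x ^ (m - k - 2) * conj x ^ (k - 1) * negPow s m))
      (kernelLapDL s x) ∧
    HasSumFrom 3 (fun m => (16 : ℝ) •
        ∑ k ∈ Icc 1 (m - 2), (((m : ℝ) - k - 1) * k) •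
          (negPow s m * par x ^ (m - k - 2) * conj x ^ (k - 1)))
      (kernelLapDR s x) ∧
    -- the left and right `D²`-kernels
    HasSumFrom 2 (fun m => (-8 : ℝ) •
        ∑ k ∈ Icc 1 (m - 1), (k : ℝ) •
          (par x ^ (m - k - 1) * conj x ^ (k - 1) * negPow s m))
      (kernelDDL s x) ∧
    HasSumFrom 2 (fun m => (-8 : ℝ) •
        ∑ k ∈ Icc 1 (m - 1), (k : ℝ) •
          (negPow s m * par x ^ (m - k - 1) * conj x ^ (k - 1)))
      (kernelDDR s x) ∧
    -- the left and right `D̄`-kernels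
    HasSumFrom 1 (fun m => (2 : ℝ) •
        (((m : ℝ) • par x ^ (m - 1) +
          (2 : ℝ) • ∑ k ∈ Icc 1 m, par x ^ (m - k) * conj x ^ (k - 1)) * negPow s m))
      (kernelDbarL s x) ∧
    HasSumFrom 1 (fun m => (2 : ℝ) •
        (negPow s m * ((m : ℝ) • par x ^ (m - 1) +
          (2 : ℝ) • ∑ k ∈ Icc 1 m, par x ^ (m - k) * conj x ^ (k - 1))))
      (kernelDbarR s x) ∧
    -- the left and right `D̄²`-kernels
    HasSumFrom 2 (fun m => (4 : ℝ) •
        (((m * ((m : ℝ) - 1)) • par x ^ (m - 2) +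
          (2 : ℝ) • ∑ k ∈ Icc 1 (m - 1), (2 * (m : ℝ) - k) •
            (par x ^ (m - k - 1) * conj x ^ (k - 1))) * negPow s m))
      (kernelDbarDbarL s x) ∧
    HasSumFrom 2 (fun m => (4 : ℝ) •
        (negPow s m * ((m * ((m : ℝ) - 1)) • par x ^ (m - 2) +
          (2 : ℝ) • ∑ k ∈ Icc 1 (m - 1), (2 * (m : ℝ) - k) •
            (par x ^ (m - k - 1) * conj x ^ (k - 1)))))
      (kernelDbarDbarR s x) ∧
    -- the left and right `ΔD̄`-kernels
    HasSumFrom 3 (fun m => (-16 : ℝ) •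
        ∑ k ∈ Icc 1 (m - 2), (((m : ℝ) - k - 1) * ((m : ℝ) + k)) •
          (par x ^ (m - k - 2) * conj x ^ (k - 1) * negPow s m))
      (kernelLapDbarL s x) ∧
    HasSumFrom 3 (fun m => (-16 : ℝ) •
        ∑ k ∈ Icc 1 (m - 2), (((m : ℝ) - k - 1) * ((m : ℝ) + k)) •
          (negPow s m * par x ^ (m - k - 2) * conj x ^ (k - 1)))
      (kernelLapDbarR s x) := by
  have hx : x ∈ Metric.ball (0 : E6) ‖s‖ := mem_ball_zero_iff.2 hxs
  have hL := isResolventSet_left s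
  have hR := isResolventSet_right s
  have eL := isExpansion_left hxs
  have eR := isExpansion_right hxs
  have fL := SL_eq_res s
  have fR := SR_eq_res s
  refine ⟨⟨isUnit_par ((norm_nonneg x).trans_lt hxs), isUnit_Qc hxs, contDiffAt_SL hxs,
    contDiffAt_SR hxs⟩, ?_, ?_, ?_, ?_, ?_, ?_, ?_, ?_, ?_, ?_, ?_, ?_, ?_, ?_⟩
  · rw [kernelDL, diracL_eq, hL.diracOf_eq_smul_pr hx fL]
    exact eL.hasSum_dirac
  · rw [kernelDR, diracR_eq, hR.diracOf_eq_smul_pr hx fR]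
    exact eR.hasSum_dirac
  · rw [kernelLapL, hL.laplacian_eq_smul_ppr hx fL]
    exact eL.hasSum_laplacian
  · rw [kernelLapR, hR.laplacian_eq_smul_ppr hx fR]
    exact eR.hasSum_laplacian
  · rw [kernelLapDL, diracL_eq, hL.laplacian_diracOf_eq hx fL]
    exact eL.hasSum_laplacian_dirac
  · rw [kernelLapDR, diracR_eq, hR.laplacian_diracOf_eq hx fR]
    exact eR.hasSum_laplacian_dirac
  · rw [kernelDDL, diracL_eq, diracL_eq, hL.diracOf_diracOf_eq hx fL]
    exact eL.hasSum_dirac_dirac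
  · rw [kernelDDR, diracR_eq, diracR_eq, hR.diracOf_diracOf_eq hx fR]
    exact eR.hasSum_dirac_dirac
  · rw [kernelDbarL, diracBarL_eq, hL.diracOf_neg_eq hx fL]
    -- Here the power of `s⁻¹` multiplies a bracket, so it must be distributed before the terms
    -- agree.
    refine hasSum_of_forall_eq eL.hasSum_diracBar fun n => ?_
    simp only [negPow, add_mul, smul_mul_assoc, sum_mul, pow_zero, mul_one]
  · rw [kernelDbarR, diracBarR_eq, hR.diracOf_neg_eq hx fR]
    refine hasSum_of_forall_eq eR.hasSum_diracBar fun n => ?_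
    simp only [negPow, mul_add, mul_smul_comm, mul_sum, pow_zero, mul_one, mul_assoc]
  · rw [kernelDbarDbarL, diracBarL_eq, diracBarL_eq, hL.diracOf_neg_diracOf_neg_eq hx fL]
    refine hasSum_of_forall_eq eL.hasSum_diracBar_diracBar fun n => ?_
    simp only [negPow, add_mul, smul_mul_assoc, sum_mul, pow_zero, mul_one]
  · rw [kernelDbarDbarR, diracBarR_eq, diracBarR_eq, hR.diracOf_neg_diracOf_neg_eq hx fR]
    refine hasSum_of_forall_eq eR.hasSum_diracBar_diracBar fun n => ?_
    simp only [negPow, mul_add, mul_smul_comm, mul_sum, pow_zero, mul_one, mul_assoc]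
  · rw [kernelLapDbarL, diracBarL_eq, hL.laplacian_diracOf_neg_eq hx fL]
    exact eL.hasSum_laplacian_diracBar
  · rw [kernelLapDbarR, diracBarR_eq, hR.diracOf_neg_laplacian_eq hx fR]
    exact eR.hasSum_laplacian_diracBar
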